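/- Let $X$ be an infinite-dimensional separable real Hilbert space with orthonormal basis $(\varphi_k)_{k\ge1}$, let $d>0$, and let $(\alpha_k)_{k\ge1}$ be a positive non-decreasing sequence with $C_-k^{2/d}\le\alpha_k\le C_+k^{2/d}$ for all $k$, where $C_->0$. Put $x_k:=\langle x,\varphi_k\rangle_X$ for $x \in X$. For $s\in\mathbb R$ let $A^sx:=\sum_k\alpha_k^s x_k\varphi_k$ on $\operatorname{dom}(A^s):=\{x\in X:\sum_k\alpha_k^{2s}x_k^2<\infty\}$, let $X^s:=\operatorname{dom}(A^{s/2})$ and $\|x\|_{X^s}:=\|A^{s/2}x\|_X$ for $s \ge 0$, and let $Kx:=\sum_ke^{-\alpha_k}x_k\varphi_k$ for $x\in X$. Let $b,r>0$ and $\beta,\tau>d/2$. Let $u$ and $\eta$ be independent $X$-valued random variables such that $u$ has the centered Gaussian distribution $\mu_0=\mathcal N_{r^2A^{-\tau}}$ with covariance operator $r^2A^{-\tau}$, and $\eta$ has the Laplacian distribution $\mathcal L_{b^2A^{-\beta}}$, i.e. $\eta=\sum_k\eta_k\varphi_k$ almost surely, with independent $\eta_k$ that are Laplace distributed on $\mathbb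 R$ with mean $0$ and variance $b^2\alpha_k^{-\beta}$. For $u,y\in X$ let $$\Phi(u,y):=\sqrt2\sum_{k=1}^\infty\frac{|y_k-e^{-\alpha_k}u_k|-|y_k|}{b\,\alpha_k^{-\beta/2}}$$ and, for $y\in X$, let $\mu^y$ be the measure on $X$ with $$\frac{d\mu^y}{d\mu_0}(u)=\frac{e^{-\Phi(u,y)}}{Z(y)},\qquad Z(y):=\int_Xe^{-\Phi(u,y)}\,\mu_0(du).$$ A functional $I:E\to\mathbb R$ is called the Onsager--Machlup functional of a probability measure $\mu$ on $X$ if $E$ is the set of all $h\in X$ for which $\mu_h:=\mu(\cdot-h)$ is equivalent to $\mu$, and $$\lim_{\varepsilon\to0}\frac{\mu(B_\varepsilon(h_1))}{\mu(B_\varepsilon(h_2))}=\exp\bigl(I(h_2)-I(h_1)\bigr)\quad\text{for all }h_1,h_2\in E.$$ **Theorem.** The family $(\mu^y)_{y\in X}$ is a regular conditional distribution of $u$ given the data $Ku+\eta$ (the posterior distribution), and $X^\tau=\operatorname{ran}(A^{-\tau/2})$. For every $y\in X$, the functional $I^y:X^\tau\to\mathbb R$, $$I^y(u):=\Phi(u,y)+\frac1{2r^2}\|u\|_{X^\tau}^2=\frac{\sqrt2}{b}\sum_{k=1}^\infty\alpha_k^{\beta/2}\bigl(|y_k-e^{-\alpha_k}u_k|-|y_k|\bigr)+\frac1{2r^2}\sum_{k=1}^\infty\alpha_k^\tau|u_k|^2,$$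 with both series convergent, is the Onsager--Machlup functional of $\mu^y$, and it has a minimizer $\bar u\in X^\tau$. -/

import Mathlib

open MeasureTheory ProbabilityTheory Filter Topology

noncomputable section

namespace OMHeat

section General

variable {X : Type*} [NormedAddCommGroup X] [InnerProductSpace ℝ X]

/-- The shifted measure `μ_h = μ(· - h)`, the image of `μ` under translation by `h`. -/
def shift [MeasurableSpace X] (μ : Measure X) (h : X) : Measure X :=
  μ.map (fun x => x + h)

/-- The shifts `h ∈ X` for which `μ_h` and `μ` are equivalent (mutually absolutely continuous). -/
def admissibleShifts [MeasurableSpace X] (μ : Measure X) : Set X :=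
  {h | shift μ h ≪ μ ∧ μ ≪ shift μ h}

/-- `I : E → ℝ` is the Onsager--Machlup functional of the measure `μ` on `X`: its domain `E` is
the set of all shifts that yield an equivalent measure, and the ratios of small ball probabilities
around points of `E` converge to the exponential of the difference of the values of `I`. -/
structure IsOnsagerMachlup [MeasurableSpace X] (μ : Measure X) (E : Set X) (I : E → ℝ) : Prop where
  domain_eq : E = admissibleShifts μ
  tendsto_ratio : ∀ h₁ h₂ : E,
    Tendsto (fun ε : ℝ => μ.real (Metric.ball (h₁ : X) ε) / μ.real (Metric.ball (h₂ : X) ε))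
      (𝓝[>] 0) (𝓝 (Real.exp (I h₂ - I h₁)))

/-- `μ` is the centered Gaussian measure `N_Q` with covariance operator `Q`. -/
structure IsCenteredGaussian [MeasurableSpace X] [BorelSpace X] (μ : Measure X) (Q : X → X) :
    Prop where
  isGaussian : IsGaussian μ
  mean_eq_zero : ∫ x, x ∂μ = 0
  covariance_eq : ∀ x y : X, covarianceBilin μ x y = inner ℝ (Q x) y

/-- The Laplace distribution on `ℝ` with mean `a` and variance `v > 0`. -/
def laplaceReal (a v : ℝ) : Measure ℝ :=
  volume.withDensity fun x =>
    ENNReal.ofReal (1 / √(2 * v) * Real.exp (-(√2 * |x - a| / √v)))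

/-- `ξ` is a Laplacian random variable with distribution `L_{a,Q}`, where `Q` has the eigensystem
`(lam k, e k)`: it is a sum `∑ ξ_k e_k` with independent real random variables `ξ_k`, each Laplace
distributed with mean `⟪a, e_k⟫` and variance `lam k`. -/
def IsLaplacian {Ω : Type*} [MeasurableSpace Ω] (P : Measure Ω) (e : ℕ → X) (lam : ℕ → ℝ) (a : X)
    (ξ : Ω → X) : Prop :=
  ∃ c : ℕ → Ω → ℝ,
    (∀ k, Measurable (c k)) ∧
    iIndepFun c P ∧
    (∀ k, P.map (c k) = laplaceReal (inner ℝ a (e k)) (lam k)) ∧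
    ∀ᵐ ω ∂P, HasSum (fun k => c k ω • e k) (ξ ω)

/-- The family `y ↦ κ y` is a regular conditional distribution of `U` given `Y`. -/
structure IsRegularCondDistrib {Ω S T : Type*} [MeasurableSpace Ω] [MeasurableSpace S]
    [MeasurableSpace T] (P : Measure Ω) (U : Ω → S) (Y : Ω → T) (κ : T → Measure S) : Prop where
  isProbabilityMeasure : ∀ y, IsProbabilityMeasure (κ y)
  measurable_apply : ∀ B : Set S, MeasurableSet B → Measurable fun y => κ y B
  disintegration : ∀ (B : Set S) (C : Set T), MeasurableSet B → MeasurableSet C →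
    P (U ⁻¹' B ∩ Y ⁻¹' C) = ∫⁻ y in C, κ y B ∂(P.map Y)

/-- The normalization constant `Z = ∫ exp (-Φ) dμ₀` in Bayes' formula. -/
def evidence [MeasurableSpace X] (μ₀ : Measure X) (Φ : X → ℝ) : ℝ :=
  ∫ u, Real.exp (-Φ u) ∂μ₀

/-- The measure given by Bayes' formula from the prior `μ₀` and the negative log-likelihood `Φ`:
its density with respect to `μ₀` is `exp (-Φ) / Z`. -/
def bayesPosterior [MeasurableSpace X] (μ₀ : Measure X) (Φ : X → ℝ) : Measure X :=
  μ₀.withDensity fun u => ENNReal.ofReal (Real.exp (-Φ u) / evidence μ₀ Φ)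

end General

section Diagonal

/-! The diagonal operator `A` with eigensystem `(α k, φ k)`; indices start at `0`. -/

variable {X : Type*} [NormedAddCommGroup X] [InnerProductSpace ℝ X]
variable (φ : HilbertBasis ℕ ℝ X) (α : ℕ → ℝ)

/-- The domain of `A ^ s`. -/
def domPow (s : ℝ) : Set X :=
  {x | Summable fun k => α k ^ (2 * s) * |inner ℝ x (φ k)| ^ 2}

/-- `A ^ s x = ∑ α_k ^ s ⟪x, φ_k⟫ φ_k`, meaningful for `x ∈ domPow φ α s`. -/
def powA (s : ℝ) (x : X) : X :=
  ∑' k, (α k ^ s * inner ℝ x (φ k)) • φ k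

/-- The space `X^s = dom (A ^ (s / 2))`. -/
def scaleSpace (s : ℝ) : Set X := domPow φ α (s / 2)

/-- The norm `‖x‖_{X^s} = ‖A ^ (s / 2) x‖`. -/
def scaleNorm (s : ℝ) (x : X) : ℝ := ‖powA φ α (s / 2) x‖

/-- The forward operator `K = exp (-A)`. -/
def forwardOp (x : X) : X :=
  ∑' k, (Real.exp (-α k) * inner ℝ x (φ k)) • φ k

/-- The negative log-likelihood `Φ(u, y)` of the data `y = K u + η` under Laplacian noise
`η ∼ L_{b² A^{-β}}`. -/
def negLogLik (b β : ℝ) (u y : X) : ℝ :=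
  √2 * ∑' k, (|inner ℝ y (φ k) - Real.exp (-α k) * inner ℝ u (φ k)| - |inner ℝ y (φ k)|) /
    (b * α k ^ (-β / 2))

/-- The functional `I^y(u) = Φ(u, y) + (1 / (2 r²)) ‖u‖²_{X^τ}` on `X^τ`. -/
def omFunctional (b β r τ : ℝ) (y : X) (u : scaleSpace φ α τ) : ℝ :=
  negLogLik φ α b β u y + 1 / (2 * r ^ 2) * scaleNorm φ α τ u ^ 2

end Diagonal

end OMHeat

end

open OMHeat

/-!
The prior and the noise are handled through one structural fact: along each basis vector `φ_k` the
coordinate is independent of the orthogonal remainder, with a Gaussian or a Laplace distribution on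
the line (`HasIndepCoord`). Statements about measures on `X` are obtained from statements on the
line by Fubini, one coordinate at a time, followed by a limit in the number of coordinates.

*Posterior.* A translate of a Laplace distribution has the density
`exp (-√2 (|s - t| - |s|) / σ)`, whose logarithm is bounded by `√2 |t| / σ`. For the translation by
`K u` these bounds are summable, because the factor `exp (-α_k)` beats all powers of `α_k`; hence
the density of the translated noise is `exp (-Φ(u, ·))` by dominated convergence
(`IsLaplacian.lintegral_add_forwardOp`). Bayes' formula is then Fubini's theorem
(`isRegularCondDistrib_of_lintegral_add`). The normalization constant is finite for every `y` by
Fernique's theorem, since `Φ(·, y)` is Lipschitz continuous uniformly in `y`.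

*Onsager--Machlup functional.* The posterior has a continuous positive density with respect to the
prior, so it suffices to know the admissible shifts and the small ball ratios of the prior `μ₀`.
Let `v_k` be the variances of the coordinates and `S = ∑ h_k² / v_k`.

* If `S` is finite, the densities of the shifts by partial sums of `h` are bounded in `L²(μ₀)`, and
  lower semicontinuity on open sets together with outer regularity gives absolute continuity
  (`map_add_absolutelyContinuous`). If `S` is infinite, the Hellinger integrals of these densities
  tend to `0`, and absolute continuity fails (`summable_of_map_add_absolutelyContinuous`).
* On the line, moving an interval of radius at most `ε` from the mean to `a` multiplies its
  Gaussian measure by a factor between `exp (-a² / 2v)` and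
  `min (1, exp (-a² / 2v + |a| ε / v))`. Applied coordinatewise this gives
  `exp (-S / 2) μ₀(B_ε(0)) ≤ μ₀(B_ε(h))`, Anderson's inequality `μ₀(B_ε(h)) ≤ μ₀(B_ε(0))`, and an
  upper bound with the factor `exp (-S_n / 2 + O(ε))` for every partial sum `S_n`. Letting `ε → 0`
  and then `n → ∞` shows that the ratio tends to `exp (-S / 2)` (`tendsto_measure_ball_div`).

*Minimizer.* The functional is a sum of functions of the single coordinates. Each has a minimizer,
and quadratic growth bounds it by a multiple of `α_k^(β/2 - τ) exp (-α_k)`, so that these minimizers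
are the coordinates of a point of `X^τ` (`exists_forall_omFunctional_le`).
-/

namespace OMHeat

open scoped ENNReal NNReal

/-! ### Measures with an independent coordinate -/

/-- Under `ν`, the coordinate along the vector `e` has the distribution `ρ` and is independent of
the remainder, which is orthogonal to `e`: `ν` is the image of a product `ρ ⊗ m` under
`(s, x) ↦ s • e + x`, with `m` concentrated on the orthogonal complement of `e`. -/
def HasIndepCoord {X : Type*} [NormedAddCommGroup X] [InnerProductSpace ℝ X] [MeasurableSpace X]
    (ν : Measure X) (e : X) (ρ : Measure ℝ) : Prop :=
  ∃ m : Measure X, IsProbabilityMeasure m ∧ (∀ᵐ x ∂m, inner ℝ x e = 0) ∧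
    ν = (ρ.prod m).map (fun p => p.1 • e + p.2)

section Coord

variable {X : Type*} [NormedAddCommGroup X] [InnerProductSpace ℝ X]
    [SecondCountableTopology X] [MeasurableSpace X] [BorelSpace X]

lemma hasIndepCoord_of_indepFun {Ω : Type*} [MeasurableSpace Ω] {P : Measure Ω}
    [IsProbabilityMeasure P] {c : Ω → ℝ} {R : Ω → X} (hc : AEMeasurable c P)
    (hR : AEMeasurable R P) (h : IndepFun c R P) {e : X} (he : ∀ᵐ ω ∂P, inner ℝ (R ω) e = 0) :
    HasIndepCoord (P.map fun ω => c ω • e + R ω) e (P.map c) := by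
  refine ⟨P.map R, Measure.isProbabilityMeasure_map hR, ?_, ?_⟩
  · rw [ae_map_iff hR]
    · exact he
    · exact measurableSet_eq_fun (by fun_prop) (by fun_prop)
  · rw [← (indepFun_iff_map_prod_eq_prod_map_map hc hR).1 h]
    rw [AEMeasurable.map_map_of_aemeasurable (by fun_prop) (hc.prodMk hR)]
    rfl

/-- Fubini for a measure with an independent coordinate. -/
lemma lintegral_map_smul_add {ρ : Measure ℝ} [SFinite ρ] {m : Measure X} [SFinite m] (e : X)
    {f : X → ℝ≥0∞} (hf : Measurable f) :
    ∫⁻ x, f x ∂((ρ.prod m).map (fun p : ℝ × X => p.1 • e + p.2)) =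
      ∫⁻ x, ∫⁻ s, f (s • e + x) ∂ρ ∂m := by
  rw [lintegral_map hf (by fun_prop), lintegral_prod_symm' _ (by fun_prop)]

/-- A quasi-invariance formula for the distribution of the coordinate along `e` yields one for
the translates in direction `e`. -/
lemma HasIndepCoord.lintegral_add_smul {ν : Measure X} {e : X} (he : ‖e‖ = 1) {ρ : Measure ℝ}
    [SFinite ρ] (h : HasIndepCoord ν e ρ) {t : ℝ} {q : ℝ → ℝ≥0∞} (hq : Measurable q)
    (hρ : ∀ f : ℝ → ℝ≥0∞, Measurable f → ∫⁻ s, f (s + t) ∂ρ = ∫⁻ s, f s * q s ∂ρ)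
    {f : X → ℝ≥0∞} (hf : Measurable f) :
    ∫⁻ x, f (x + t • e) ∂ν = ∫⁻ x, f x * q (inner ℝ x e) ∂ν := by
  obtain ⟨m, hm, hme, rfl⟩ := h
  rw [lintegral_map_smul_add e (by fun_prop), lintegral_map_smul_add e (by fun_prop)]
  refine lintegral_congr_ae ?_
  filter_upwards [hme] with x hx
  have h1 := hρ (fun s => f (s • e + x)) (by fun_prop)
  simp only [inner_add_left, inner_smul_left, real_inner_self_eq_norm_sq, he, hx]
  simp only [one_pow, conj_trivial, mul_one, add_zero]
  rw [← h1]
  congr 1 with s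
  rw [add_smul]; congr 1; abel

/-- Translations along finitely many orthonormal directions: the one-coordinate densities
multiply, since each depends on its own coordinate only. -/
lemma lintegral_add_sum_smul {ν : Measure X} {e : ℕ → X} (he : Orthonormal ℝ e) {t : ℕ → ℝ}
    {w : ℕ → ℝ → ℝ} (hw : ∀ k, Measurable (w k))
    (h : ∀ k, ∀ f : X → ℝ≥0∞, Measurable f → ∫⁻ x, f (x + t k • e k) ∂ν =
      ∫⁻ x, f x * ENNReal.ofReal (Real.exp (w k (inner ℝ x (e k)))) ∂ν)
    (n : ℕ) {f : X → ℝ≥0∞} (hf : Measurable f) :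
    ∫⁻ x, f (x + ∑ k ∈ Finset.range n, t k • e k) ∂ν =
      ∫⁻ x, f x * ENNReal.ofReal
        (Real.exp (∑ k ∈ Finset.range n, w k (inner ℝ x (e k)))) ∂ν := by
  induction n generalizing f with
  | zero => simp
  | succ n ih =>
    have hm : ∀ k, Measurable fun x : X => w k (inner ℝ x (e k)) := fun k =>
      (hw k).comp (by fun_prop)
    have h1 := ih (f := fun x => f (x + t n • e n)) (by fun_prop)
    have h2 := h n (fun x => f x * ENNReal.ofReal
        (Real.exp (∑ k ∈ Finset.range n, w k (inner ℝ x (e k))))) (by fun_prop)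
    simp only [Finset.sum_range_succ]
    simp only [← add_assoc]
    rw [h1]
    calc _ = _ := ?_
      _ = _ := h2
      _ = _ := ?_
    · congr 1 with x
      congr 3
      refine Finset.sum_congr rfl fun k hk => ?_
      have : k ≠ n := (Finset.mem_range.1 hk).ne
      rw [inner_add_left, inner_smul_left, he.2 this.symm]
      simp
    · congr 1 with x
      rw [Real.exp_add, ENNReal.ofReal_mul (Real.exp_pos _).le, mul_assoc]

/-! ### Quasi-invariance of distributions on the line -/

lemma lintegral_add_withDensity_volume {g q : ℝ → ℝ≥0∞} (hg : Measurable g) (hq : Measurable q)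
    {t : ℝ} (h : ∀ s, g (s - t) = g s * q s) {f : ℝ → ℝ≥0∞} (hf : Measurable f) :
    ∫⁻ s, f (s + t) ∂(volume.withDensity g) = ∫⁻ s, f s * q s ∂(volume.withDensity g) := by
  rw [lintegral_withDensity_eq_lintegral_mul _ hg (by fun_prop),
    lintegral_withDensity_eq_lintegral_mul _ hg (by fun_prop),
    ← lintegral_sub_right_eq_self _ t]
  congr 1 with s
  simp [h, mul_comm, mul_left_comm]

lemma lintegral_add_gaussianReal {v : ℝ≥0} (hv : v ≠ 0) (t : ℝ) {f : ℝ → ℝ≥0∞}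
    (hf : Measurable f) :
    ∫⁻ s, f (s + t) ∂(gaussianReal 0 v) =
      ∫⁻ s, f s * ENNReal.ofReal (Real.exp (t * s / v - t ^ 2 / (2 * v))) ∂(gaussianReal 0 v) := by
  rw [gaussianReal_of_var_ne_zero _ hv]
  refine lintegral_add_withDensity_volume (by fun_prop) (by fun_prop) (fun s => ?_) hf
  have : (v : ℝ) ≠ 0 := by exact_mod_cast hv
  rw [gaussianPDF, gaussianPDF, ← ENNReal.ofReal_mul (gaussianPDFReal_nonneg _ _ _),
    gaussianPDFReal, gaussianPDFReal, mul_assoc _ (Real.exp _), ← Real.exp_add]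
  congr 3
  field_simp
  ring

lemma lintegral_add_laplaceReal (v t : ℝ) {f : ℝ → ℝ≥0∞} (hf : Measurable f) :
    ∫⁻ s, f (s + t) ∂(laplaceReal 0 v) =
      ∫⁻ s, f s * ENNReal.ofReal (Real.exp (-(√2 * (|s - t| - |s|) / √v))) ∂(laplaceReal 0 v) := by
  rw [laplaceReal]
  refine lintegral_add_withDensity_volume (by fun_prop) (by fun_prop) (fun s => ?_) hf
  rw [← ENNReal.ofReal_mul (by positivity), mul_assoc, ← Real.exp_add]
  congr 3
  simp only [sub_zero]
  ring

/-- The one-dimensional case of Anderson's inequality: among the intervals of a given length, the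
one centred at the mean has the largest Gaussian measure. -/
lemma gaussianReal_ball_le {v : ℝ≥0} (hv : v ≠ 0) (a δ : ℝ) :
    gaussianReal 0 v {s | (s - a) ^ 2 < δ} ≤ gaussianReal 0 v {s | s ^ 2 < δ} := by
  have hm1 : MeasurableSet {s : ℝ | (s - a) ^ 2 < δ} :=
    measurableSet_lt (by fun_prop) (by fun_prop)
  have hm0 : MeasurableSet {s : ℝ | s ^ 2 < δ} := measurableSet_lt (by fun_prop) (by fun_prop)
  rw [← measure_sdiff_add_inter _ hm0, ← measure_sdiff_add_inter {s : ℝ | s ^ 2 < δ} hm1,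
    Set.inter_comm]
  gcongr ?_ + _
  rw [gaussianReal_of_var_ne_zero _ hv, withDensity_apply _ (hm1.diff hm0),
    withDensity_apply _ (hm0.diff hm1), ← lintegral_indicator (hm1.diff hm0),
    ← lintegral_indicator (hm0.diff hm1)]
  -- the reflection `s ↦ a - s` exchanges the two intervals
  rw [← lintegral_sub_left_eq_self _ a]
  refine lintegral_mono fun s => ?_
  by_cases hs : (a - s) ∈ {s : ℝ | (s - a) ^ 2 < δ} \ {s : ℝ | s ^ 2 < δ}
  · have hs2 : s ∈ {s : ℝ | s ^ 2 < δ} \ {s : ℝ | (s - a) ^ 2 < δ} := by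
      simp only [Set.mem_sdiff, Set.mem_ofPred_eq] at hs ⊢
      constructor
      · convert hs.1 using 1; ring
      · convert hs.2 using 2; ring
    rw [Set.indicator_of_mem hs, Set.indicator_of_mem hs2, gaussianPDF, gaussianPDF]
    refine ENNReal.ofReal_le_ofReal ?_
    rw [gaussianPDFReal, gaussianPDFReal]
    gcongr 2
    have h1 := hs2.1
    have h2 := hs2.2
    simp only [Set.mem_ofPred_eq] at h1 h2
    gcongr 1
    nlinarith
  · rw [Set.indicator_of_notMem hs]; exact zero_le

end Coord

/-! ### Coordinates of the prior and of the noise -/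

section Laws

variable {X : Type*} [NormedAddCommGroup X] [InnerProductSpace ℝ X] [CompleteSpace X]
    [SecondCountableTopology X] [MeasurableSpace X] [BorelSpace X]

/-- A Gaussian measure has independent coordinates along the eigenvectors of its covariance
operator: for jointly Gaussian variables, uncorrelated implies independent. -/
lemma IsCenteredGaussian.hasIndepCoord {μ : Measure X} {Q : X → X} (hμ : IsCenteredGaussian μ Q)
    {e : X} (he : ‖e‖ = 1) {v : ℝ≥0} (hQ : Q e = (v : ℝ) • e) :
    HasIndepCoord μ e (gaussianReal 0 v) := by
  have := hμ.isGaussian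
  have hid : MemLp id 2 μ := IsGaussian.memLp_two_id
  let L : X →L[ℝ] ℝ := innerSL ℝ e
  have hL : ∀ x, L x = inner ℝ e x := fun x => innerSL_apply_apply ..
  let M : X →L[ℝ] X := ContinuousLinearMap.id ℝ X - L.smulRight e
  have hM : ∀ x, M x = x - inner ℝ e x • e := fun x => by simp [M, hL]
  have hG : HasGaussianLaw (fun x => (L x, M x)) μ :=
    (IsGaussian.hasGaussianLaw_id (μ := μ)).map_fun (L.prod M)
  have hind : IndepFun (fun x => L x) (fun x => M x) μ := by
    refine hG.indepFun_of_covariance_inner fun s y => ?_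
    have h1 : (fun x => inner ℝ s (L x)) = fun x => inner ℝ (s • e) x := by
      ext x; simp [hL, inner_smul_left, mul_comm]
    have h2 : (fun x => inner ℝ y (M x)) = fun x => inner ℝ (y - inner ℝ e y • e) x := by
      ext x
      simp only [hM, inner_sub_right, inner_sub_left, inner_smul_left, inner_smul_right,
        conj_trivial, real_inner_comm y e]
      ring
    rw [h1, h2, ← covarianceBilin_apply_eq_cov hid, map_smul, _root_.smul_apply,
      hμ.covariance_eq, hQ, inner_smul_left, inner_sub_right, inner_smul_right,
      real_inner_self_eq_norm_sq, he]
    simp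
  have hlaw : μ.map (fun x => L x) = gaussianReal 0 v := by
    have h0 := ((IsGaussian.hasGaussianLaw_id (μ := μ)).map_fun L).map_eq_gaussianReal
    simp only [id] at h0
    rw [h0]
    congr 1
    · have := ContinuousLinearMap.integral_comp_comm L (hid.integrable (by norm_num))
      simp only [id] at this
      simp [this, hμ.mean_eq_zero]
    · have := covarianceBilin_self hid e
      simp only [hL]
      rw [← this, hμ.covariance_eq, hQ, inner_smul_left, real_inner_self_eq_norm_sq, he]
      simp
  have h := hasIndepCoord_of_indepFun (e := e) (by fun_prop) (by fun_prop) hind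
    (Eventually.of_forall fun x => by
      simp [hM, inner_sub_left, inner_smul_left, he, real_inner_comm])
  rw [hlaw] at h
  convert h
  have : (fun x => L x • e + M x) = id := by ext x; simp [hM, hL]
  rw [this, Measure.map_id]

/-- A random series `∑ c_k e_k` along an orthonormal sequence, with independent `c_k`, has
independent coordinates. -/
lemma hasIndepCoord_map_of_hasSum {Ω : Type*} [MeasurableSpace Ω] {P : Measure Ω}
    [IsProbabilityMeasure P] {e : ℕ → X} (he : Orthonormal ℝ e) {c : ℕ → Ω → ℝ}
    (hc : ∀ k, Measurable (c k)) (hindep : iIndepFun c P) {ξ : Ω → X}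
    (hξ : ∀ᵐ ω ∂P, HasSum (fun k => c k ω • e k) (ξ ω)) (k : ℕ) :
    HasIndepCoord (P.map ξ) (e k) (P.map (c k)) := by
  classical
  -- the sequence of the coefficients other than `c k`
  let T : Ω → ℕ → ℝ := fun ω j => if j = k then 0 else c j ω
  have hT : Measurable T := by
    refine measurable_pi_iff.2 fun j => ?_
    by_cases hj : j = k <;> simp [T, hj, hc]
  have hind : IndepFun (c k) T P := by
    have h1 := indep_iSup_of_disjoint (fun i => (hc i).comap_le) hindep
      (disjoint_compl_right (a := ({k} : Set ℕ)))
    rw [IndepFun_iff_Indep]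
    refine indep_of_indep_of_le_left (indep_of_indep_of_le_right h1 ?_) ?_
    · rw [← measurable_iff_comap_le]
      refine (@measurable_pi_iff _ _ _ (_) _ _).2 fun j => ?_
      by_cases hj : j = k
      · simp [T, hj]
      · simp only [T, hj, if_false]
        rw [measurable_iff_comap_le]
        exact le_iSup₂ (f := fun (i : ℕ) (_ : i ∈ ({k} : Set ℕ)ᶜ) =>
          MeasurableSpace.comap (c i) inferInstance) j hj
    · exact le_iSup₂ (f := fun (i : ℕ) (_ : i ∈ ({k} : Set ℕ)) =>
          MeasurableSpace.comap (c i) inferInstance) k rfl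
  have hlim : ∀ᵐ ω ∂P, Tendsto (fun n => ∑ j ∈ Finset.range n, T ω j • e j) atTop
      (𝓝 (ξ ω - c k ω • e k)) := by
    filter_upwards [hξ] with ω hω
    have h1 := (hω.update k 0).tendsto_sum_nat
    rw [zero_sub, neg_add_eq_sub] at h1
    refine h1.congr fun n => Finset.sum_congr rfl fun j _ => ?_
    by_cases hj : j = k
    · subst hj; simp [T]
    · simp [T, hj]
  obtain ⟨F, hF, hFlim⟩ := measurable_limit_of_tendsto_metrizable_ae (μ := P.map T) (L := atTop)
    (f := fun (n : ℕ) (s : ℕ → ℝ) => ∑ j ∈ Finset.range n, s j • e j)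
    (fun n => Measurable.aemeasurable (by fun_prop)) (by
      rw [ae_map_iff hT.aemeasurable]
      · filter_upwards [hlim] with ω hω using ⟨_, hω⟩
      · exact measurableSet_exists_tendsto (fun n => by fun_prop))
  have hFe : ∀ᵐ ω ∂P, F (T ω) = ξ ω - c k ω • e k := by
    filter_upwards [ae_of_ae_map hT.aemeasurable hFlim, hlim] with ω h1 h2
    exact tendsto_nhds_unique h1 h2
  have hmain := hasIndepCoord_of_indepFun (P := P) (c := c k) (R := F ∘ T) (e := e k)
    (hc k).aemeasurable (hF.comp hT).aemeasurable (hind.comp measurable_id hF) (by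
      filter_upwards [hFe, hξ] with ω h1 h2
      have h3 := (h2.mapL (innerSL ℝ (e k)))
      simp only [innerSL_apply_apply, inner_smul_right, orthonormal_iff_ite.1 he] at h3
      have h4 := h3.unique (hasSum_single k fun j hj => by simp [hj.symm])
      simp only [Function.comp_apply, h1, inner_sub_left, inner_smul_left, he.1,
        real_inner_self_eq_norm_sq]
      rw [real_inner_comm, h4]
      simp)
  convert hmain using 1
  refine Measure.map_congr ?_
  filter_upwards [hFe] with ω h1
  simp [h1]

end Laws

/-! ### Translations of the noise -/

section NoiseShift

variable {X : Type*} [NormedAddCommGroup X] [InnerProductSpace ℝ X]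
    [SecondCountableTopology X] [MeasurableSpace X] [BorelSpace X]

/-- Passage from finitely many to infinitely many directions of translation: if the logarithms of
the one-coordinate densities are summable with a uniform bound, dominated convergence identifies
the density for the whole translation. -/
lemma lintegral_add_of_summable {ν : Measure X} [IsProbabilityMeasure ν] {e : ℕ → X}
    (he : Orthonormal ℝ e) {t : ℕ → ℝ} {h : X} (hh : HasSum (fun k => t k • e k) h)
    {w : ℕ → ℝ → ℝ} (hw : ∀ k, Measurable (w k)) {B : ℕ → ℝ} (hB : Summable B)
    (hwB : ∀ k s, |w k s| ≤ B k)
    (hk : ∀ k, ∀ f : X → ℝ≥0∞, Measurable f → ∫⁻ x, f (x + t k • e k) ∂ν =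
      ∫⁻ x, f x * ENNReal.ofReal (Real.exp (w k (inner ℝ x (e k)))) ∂ν)
    {f : X → ℝ≥0∞} (hf : Measurable f) :
    ∫⁻ x, f (x + h) ∂ν =
      ∫⁻ x, f x * ENNReal.ofReal (Real.exp (∑' k, w k (inner ℝ x (e k)))) ∂ν := by
  have hm : ∀ k, Measurable fun x : X => w k (inner ℝ x (e k)) := fun k =>
    (hw k).comp (by fun_prop)
  have hsum : ∀ x : X, Summable fun k => w k (inner ℝ x (e k)) := fun x =>
    Summable.of_norm_bounded hB fun k => hwB k _
  have hmD : Measurable fun x : X => ∑' k, w k (inner ℝ x (e k)) :=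
    measurable_of_tendsto_metrizable (f := fun n x => ∑ k ∈ Finset.range n, w k (inner ℝ x (e k)))
      (fun n => by fun_prop) (tendsto_pi_nhds.2 fun x => (hsum x).hasSum.tendsto_sum_nat)
  have hB0 : ∀ k, 0 ≤ B k := fun k => (abs_nonneg _).trans (hwB k 0)
  have key : ν.map (fun x => x + h) = ν.withDensity fun x =>
      ENNReal.ofReal (Real.exp (∑' k, w k (inner ℝ x (e k)))) := by
    have : IsProbabilityMeasure (ν.map (fun x => x + h)) :=
      Measure.isProbabilityMeasure_map (by fun_prop)
    refine ext_of_forall_lintegral_eq_of_IsFiniteMeasure fun g => ?_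
    have hg : Measurable fun x => (g x : ℝ≥0∞) := by
      exact g.continuous.measurable.coe_nnreal_ennreal
    obtain ⟨C, hC⟩ : ∃ C : ℝ≥0, ∀ x, g x ≤ C := by
      refine ⟨nndist g 0, fun x => ?_⟩
      have := BoundedContinuousFunction.nndist_coe_le_nndist (f := g) (g := 0) x
      refine le_trans ?_ this
      exact (NNReal.nndist_zero_eq_val' (g x)).ge
    rw [lintegral_map hg (by fun_prop), lintegral_withDensity_eq_lintegral_mul _ (by fun_prop) hg]
    have h1 : Tendsto (fun n => ∫⁻ x, (g (x + ∑ k ∈ Finset.range n, t k • e k) : ℝ≥0∞) ∂ν) atTop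
        (𝓝 (∫⁻ x, (g (x + h) : ℝ≥0∞) ∂ν)) := by
      refine tendsto_lintegral_of_dominated_convergence (fun _ => (C : ℝ≥0∞))
        (fun n => hg.comp (by fun_prop))
        (fun n => Eventually.of_forall fun x => ENNReal.coe_le_coe.2 (hC _)) (by simp)
        (Eventually.of_forall fun x => ?_)
      refine ENNReal.tendsto_coe.2 ((g.continuous.tendsto _).comp ?_)
      exact tendsto_const_nhds.add hh.tendsto_sum_nat
    have h2 : Tendsto (fun n => ∫⁻ x, (g x : ℝ≥0∞) * ENNReal.ofReal
        (Real.exp (∑ k ∈ Finset.range n, w k (inner ℝ x (e k)))) ∂ν) atTop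
        (𝓝 (∫⁻ x, (g x : ℝ≥0∞) * ENNReal.ofReal
          (Real.exp (∑' k, w k (inner ℝ x (e k)))) ∂ν)) := by
      refine tendsto_lintegral_of_dominated_convergence
        (fun _ => (C : ℝ≥0∞) * ENNReal.ofReal (Real.exp (∑' k, B k)))
        (fun n => by fun_prop) (fun n => Eventually.of_forall fun x => ?_)
        (by simp [ENNReal.mul_eq_top]) (Eventually.of_forall fun x => ?_)
      · refine mul_le_mul' (ENNReal.coe_le_coe.2 (hC x))
          (ENNReal.ofReal_le_ofReal (Real.exp_le_exp.2 ?_))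
        · refine le_trans (Finset.sum_le_sum fun k _ => (le_abs_self _).trans (hwB k _)) ?_
          exact hB.sum_le_tsum _ fun k _ => hB0 k
      · refine ENNReal.Tendsto.const_mul ?_ (Or.inr ENNReal.coe_ne_top)
        exact ((ENNReal.continuous_ofReal.comp Real.continuous_exp).tendsto _).comp
          (hsum x).hasSum.tendsto_sum_nat
    refine (tendsto_nhds_unique h1 (h2.congr fun n => ?_)).trans ?_
    · exact (lintegral_add_sum_smul he hw hk n hg).symm
    · simp [mul_comm]
  rw [← lintegral_map hf (by fun_prop), key,
    lintegral_withDensity_eq_lintegral_mul _ (by fun_prop) hf]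
  simp [mul_comm]

end NoiseShift

/-! ### Small balls of a Gaussian measure -/

lemma gaussianReal_ball_eq_lintegral {v : ℝ≥0} (hv : v ≠ 0) (a δ : ℝ) :
    gaussianReal 0 v {s | (s - a) ^ 2 < δ} =
      ∫⁻ s in {s | s ^ 2 < δ},
        ENNReal.ofReal (Real.exp (-a ^ 2 / (2 * v)) * Real.exp (-(a * s) / v))
          ∂(gaussianReal 0 v) := by
  have hm1 : MeasurableSet {s : ℝ | (s - a) ^ 2 < δ} :=
    measurableSet_lt (by fun_prop) (by fun_prop)
  have hm0 : MeasurableSet {s : ℝ | s ^ 2 < δ} := measurableSet_lt (by fun_prop) (by fun_prop)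
  rw [← lintegral_indicator_one hm1, ← lintegral_indicator hm0]
  have h := lintegral_add_gaussianReal hv (-a) (f := Set.indicator {s : ℝ | s ^ 2 < δ} 1)
    (measurable_one.indicator hm0)
  calc _ = _ := ?_
    _ = _ := h
    _ = _ := ?_
  · rfl
  · congr 1 with s
    by_cases hs : s ∈ {s : ℝ | s ^ 2 < δ}
    · simp only [Set.indicator_of_mem hs, Pi.one_apply, one_mul, ← Real.exp_add]
      congr 2; ring
    · simp [Set.indicator_of_notMem hs]

/-- An interval loses at most the Cameron--Martin factor when it is moved away from the mean:
average the density over `s` and `-s`. -/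
lemma le_gaussianReal_ball {v : ℝ≥0} (hv : v ≠ 0) (a δ : ℝ) :
    ENNReal.ofReal (Real.exp (-a ^ 2 / (2 * v))) * gaussianReal 0 v {s | s ^ 2 < δ} ≤
      gaussianReal 0 v {s | (s - a) ^ 2 < δ} := by
  have hm0 : MeasurableSet {s : ℝ | s ^ 2 < δ} := measurableSet_lt (by fun_prop) (by fun_prop)
  have hneg : ∫⁻ s in {s | s ^ 2 < δ}, ENNReal.ofReal
        (Real.exp (-a ^ 2 / (2 * v)) * Real.exp (-(a * s) / v)) ∂(gaussianReal 0 v) =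
      ∫⁻ s in {s | s ^ 2 < δ}, ENNReal.ofReal
        (Real.exp (-a ^ 2 / (2 * v)) * Real.exp ((a * s) / v)) ∂(gaussianReal 0 v) := by
    have h1 : (gaussianReal 0 v).map (fun s => -s) = gaussianReal 0 v := by
      rw [gaussianReal_map_neg, neg_zero]
    conv_lhs => rw [← h1]
    rw [setLIntegral_map hm0 (by fun_prop) (by fun_prop)]
    simp
  rw [← ENNReal.mul_le_mul_iff_right (a := 2) (by norm_num) (by norm_num), two_mul (_ : ℝ≥0∞),
    two_mul (_ : ℝ≥0∞)]
  calc _ = ∫⁻ s in {s | s ^ 2 < δ}, ENNReal.ofReal (Real.exp (-a ^ 2 / (2 * v)) * 2)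
        ∂(gaussianReal 0 v) := by
        rw [lintegral_const, Measure.restrict_apply_univ, ENNReal.ofReal_mul (Real.exp_pos _).le]
        rw [show ENNReal.ofReal 2 = 2 by simp]
        ring
    _ ≤ ∫⁻ s in {s | s ^ 2 < δ},
        (ENNReal.ofReal (Real.exp (-a ^ 2 / (2 * v)) * Real.exp (-(a * s) / v)) +
        ENNReal.ofReal (Real.exp (-a ^ 2 / (2 * v)) * Real.exp ((a * s) / v)))
        ∂(gaussianReal 0 v) := by
        refine lintegral_mono fun s => ?_
        rw [← ENNReal.ofReal_add (by positivity) (by positivity), ← mul_add]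
        gcongr
        have h1 := Real.add_one_le_exp (-(a * s) / v)
        have h2 := Real.add_one_le_exp ((a * s) / v)
        have h3 : -(a * s) / (v : ℝ) = - ((a * s) / v) := by ring
        rw [h3] at h1 ⊢
        linarith
    _ = _ := by
        rw [lintegral_add_left (by fun_prop), ← hneg, ← gaussianReal_ball_eq_lintegral hv]

lemma gaussianReal_ball_le_exp_mul {v : ℝ≥0} (hv : v ≠ 0) (a : ℝ) {δ ε : ℝ} (hε : 0 ≤ ε)
    (hδ : δ ≤ ε ^ 2) :
    gaussianReal 0 v {s | (s - a) ^ 2 < δ} ≤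
      ENNReal.ofReal (Real.exp (-a ^ 2 / (2 * v) + |a| / v * ε)) *
        gaussianReal 0 v {s | s ^ 2 < δ} := by
  have hm0 : MeasurableSet {s : ℝ | s ^ 2 < δ} := measurableSet_lt (by fun_prop) (by fun_prop)
  rw [gaussianReal_ball_eq_lintegral hv, ← setLIntegral_const]
  refine setLIntegral_mono' hm0 fun s hs => ENNReal.ofReal_le_ofReal ?_
  rw [← Real.exp_add]
  refine Real.exp_le_exp.2 (add_le_add le_rfl ?_)
  rw [div_mul_eq_mul_div]
  gcongr
  have h1 : |s| ≤ ε := abs_le_of_sq_le_sq ((show s ^ 2 < δ from hs).le.trans hδ) hε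
  calc -(a * s) ≤ |a * s| := neg_le_abs _
    _ = |a| * |s| := abs_mul _ _
    _ ≤ _ := by gcongr

lemma measure_ball_le_of_forall_lt {X : Type*} [PseudoMetricSpace X] [MeasurableSpace X]
    {μ : Measure X} {z : X} {ε : ℝ} {C M : ℝ≥0∞}
    (h : ∀ ε' < ε, C * μ (Metric.ball z ε') ≤ M) : C * μ (Metric.ball z ε) ≤ M := by
  have hU : Metric.ball z ε = ⋃ n : ℕ, Metric.ball z (ε - 1 / ((n : ℝ) + 1)) := by
    ext x
    simp only [Metric.mem_ball, Set.mem_iUnion]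
    constructor
    · intro hx
      obtain ⟨n, hn⟩ := exists_nat_one_div_lt (sub_pos.2 hx)
      exact ⟨n, by linarith⟩
    · rintro ⟨n, hn⟩
      have : 0 < 1 / ((n : ℝ) + 1) := Nat.one_div_pos_of_nat
      linarith
  have hmono : Monotone fun n : ℕ => Metric.ball z (ε - 1 / ((n : ℝ) + 1)) := fun i j hij =>
    Metric.ball_subset_ball (sub_le_sub_left (Nat.one_div_le_one_div hij) _)
  rw [hU, hmono.measure_iUnion, ENNReal.mul_iSup]
  refine iSup_le fun n => h _ ?_
  have : 0 < 1 / ((n : ℝ) + 1) := Nat.one_div_pos_of_nat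
  linarith

section Tail

variable {X : Type*} [NormedAddCommGroup X] [InnerProductSpace ℝ X]

/-- The remainder of the expansion of `x` in an orthonormal sequence after `n` terms. -/
def tail (e : ℕ → X) (x : X) (n : ℕ) : X := x - ∑ k ∈ Finset.range n, inner ℝ x (e k) • e k

lemma tail_succ (e : ℕ → X) (x : X) (n : ℕ) :
    tail e x (n + 1) + inner ℝ x (e n) • e n = tail e x n := by
  simp only [tail, Finset.sum_range_succ]
  abel

lemma inner_tail_succ {e : ℕ → X} (he : Orthonormal ℝ e) (x : X) (n : ℕ) :
    inner ℝ (tail e x (n + 1)) (e n) = 0 := by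
  simp [tail, inner_sub_left, sum_inner, inner_smul_left, orthonormal_iff_ite.1 he]

lemma hasSum_inner_smul (φ : HilbertBasis ℕ ℝ X) (x : X) :
    HasSum (fun k => inner ℝ x (φ k) • φ k) x := by
  convert φ.hasSum_repr x using 3 with k
  rw [φ.repr_apply_apply, real_inner_comm]

lemma tendsto_norm_tail (φ : HilbertBasis ℕ ℝ X) (x : X) :
    Tendsto (fun n => ‖tail φ x n‖) atTop (𝓝 0) := by
  have h := tendsto_const_nhds (x := x).sub (hasSum_inner_smul φ x).tendsto_sum_nat
  rw [sub_self] at h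
  simpa [tail] using h.norm

end Tail

section SmallBall

variable {X : Type*} [NormedAddCommGroup X] [InnerProductSpace ℝ X]
    [SecondCountableTopology X] [MeasurableSpace X] [BorelSpace X]

/-- The slices of a ball in direction `e` are intervals with a common centre, so that an inequality
between the measures of intervals lifts to an inequality between the measures of balls. -/
lemma HasIndepCoord.measure_ball_le {μ : Measure X} {e : X} (he : ‖e‖ = 1) {ρ : Measure ℝ}
    [SFinite ρ] (h : HasIndepCoord μ e ρ) {a b ε : ℝ} {C : ℝ≥0∞} (hε : 0 ≤ ε)
    (hC : ∀ δ, δ ≤ ε ^ 2 → ρ {s | (s - a) ^ 2 < δ} ≤ C * ρ {s | (s - b) ^ 2 < δ})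
    {z : X} (hz : inner ℝ z e = 0) :
    μ (Metric.ball (z + a • e) ε) ≤ C * μ (Metric.ball (z + b • e) ε) := by
  obtain ⟨m, hm, hme, rfl⟩ := h
  have key : ∀ (x : X), inner ℝ x e = 0 → ∀ c s : ℝ,
      s • e + x ∈ Metric.ball (z + c • e) ε ↔ (s - c) ^ 2 < ε ^ 2 - ‖x - z‖ ^ 2 := by
    intro x hx c s
    have h1 : s • e + x - (z + c • e) = (s - c) • e + (x - z) := by rw [sub_smul]; abel
    have h2 : ‖(s - c) • e + (x - z)‖ ^ 2 = (s - c) ^ 2 + ‖x - z‖ ^ 2 := by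
      rw [norm_add_sq_real, inner_smul_left, inner_sub_right, real_inner_comm x,
        real_inner_comm z, hx, hz, norm_smul, he]
      simp
    rw [Metric.mem_ball, dist_eq_norm, h1, ← sq_lt_sq₀ (norm_nonneg _) hε, h2]
    constructor <;> intro h <;> linarith
  have hI : ∀ (x : X), inner ℝ x e = 0 → ∀ c : ℝ,
      ∫⁻ s, (Metric.ball (z + c • e) ε).indicator 1 (s • e + x) ∂ρ =
        ρ {s | (s - c) ^ 2 < ε ^ 2 - ‖x - z‖ ^ 2} := by
    intro x hx c
    rw [← lintegral_indicator_one (measurableSet_lt (by fun_prop) (by fun_prop))]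
    congr 1 with s
    by_cases hs : (s - c) ^ 2 < ε ^ 2 - ‖x - z‖ ^ 2
    · rw [Set.indicator_of_mem ((key x hx c s).2 hs), Set.indicator_of_mem (by exact hs)]
      rfl
    · rw [Set.indicator_of_notMem (mt (key x hx c s).1 hs), Set.indicator_of_notMem (by exact hs)]
  have hmeas : ∀ c : ℝ, Measurable
      ((Metric.ball (z + c • e) ε).indicator (1 : X → ℝ≥0∞)) := fun c =>
    measurable_one.indicator measurableSet_ball
  rw [← lintegral_indicator_one measurableSet_ball, ← lintegral_indicator_one measurableSet_ball,
    lintegral_map_smul_add e (hmeas a), lintegral_map_smul_add e (hmeas b),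
    ← lintegral_const_mul]
  · refine lintegral_mono_ae ?_
    filter_upwards [hme] with x hx
    rw [hI x hx, hI x hx]
    exact hC _ (by nlinarith [sq_nonneg ‖x - z‖])
  · exact ((hmeas b).comp (f := fun p : X × ℝ => p.2 • e + p.1)
      (by fun_prop)).lintegral_prod_right'

/-- **Anderson's inequality** for the balls of a Hilbert space and a measure with independent
centred Gaussian coordinates. -/
lemma measure_ball_le_measure_ball_zero (φ : HilbertBasis ℕ ℝ X) {μ : Measure X} {v : ℕ → ℝ≥0}
    (hv : ∀ k, v k ≠ 0) (h : ∀ k, HasIndepCoord μ (φ k) (gaussianReal 0 (v k))) (z : X)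
    (ε : ℝ) : μ (Metric.ball z ε) ≤ μ (Metric.ball 0 ε) := by
  have hstep : ∀ ε : ℝ, 0 ≤ ε → ∀ n, μ (Metric.ball z ε) ≤ μ (Metric.ball (tail φ z n) ε) := by
    intro ε hε n
    induction n with
    | zero => simp [tail]
    | succ n ih =>
      refine ih.trans ?_
      have := (h n).measure_ball_le (φ.orthonormal.1 n) (a := inner ℝ z (φ n)) (b := 0) (C := 1)
        hε (fun δ _ => by simpa using gaussianReal_ball_le (hv n) (inner ℝ z (φ n)) δ)
        (inner_tail_succ φ.orthonormal z n)
      simpa [tail_succ] using this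
  rw [← one_mul (μ (Metric.ball z ε))]
  refine measure_ball_le_of_forall_lt fun ε' hε' => ?_
  rw [one_mul]
  rcases lt_or_ge ε' 0 with h0 | h0
  · simp [Metric.ball_eq_empty.2 h0.le]
  obtain ⟨n, hn⟩ := ((tendsto_norm_tail φ z).eventually_lt_const (sub_pos.2 hε')).exists
  refine (hstep ε' h0 n).trans (measure_mono (Metric.ball_subset_ball' ?_))
  rw [dist_zero_right]; linarith

/-- The lower bound for shifted balls, by the exact Cameron--Martin factor. -/
lemma exp_mul_measure_ball_zero_le (φ : HilbertBasis ℕ ℝ X) {μ : Measure X} {v : ℕ → ℝ≥0}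
    (hv : ∀ k, v k ≠ 0) (h : ∀ k, HasIndepCoord μ (φ k) (gaussianReal 0 (v k))) {z : X}
    (hz : Summable fun k => inner ℝ z (φ k) ^ 2 / v k) {ε : ℝ} (hε : 0 ≤ ε) :
    ENNReal.ofReal (Real.exp (-(∑' k, inner ℝ z (φ k) ^ 2 / v k) / 2)) * μ (Metric.ball 0 ε) ≤
      μ (Metric.ball z ε) := by
  have hstep : ∀ n, ENNReal.ofReal
      (Real.exp (-(∑ k ∈ Finset.range n, inner ℝ z (φ k) ^ 2 / v k) / 2)) *
        μ (Metric.ball (tail φ z n) ε) ≤ μ (Metric.ball z ε) := by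
    intro n
    induction n with
    | zero => simp [tail]
    | succ n ih =>
      refine le_trans ?_ ih
      have := (h n).measure_ball_le (φ.orthonormal.1 n) (a := 0) (b := inner ℝ z (φ n))
        (C := ENNReal.ofReal (Real.exp (inner ℝ z (φ n) ^ 2 / (2 * v n))))
        hε (fun δ _ => ?_) (inner_tail_succ φ.orthonormal z n)
      · rw [zero_smul, add_zero, tail_succ] at this
        refine (mul_le_mul_right this _).trans_eq ?_
        rw [← mul_assoc, ← ENNReal.ofReal_mul (Real.exp_pos _).le, ← Real.exp_add,
          Finset.sum_range_succ]
        congr 4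
        field_simp
        ring
      · have h1 := mul_le_mul_right (le_gaussianReal_ball (hv n) (inner ℝ z (φ n)) δ)
          (ENNReal.ofReal (Real.exp (inner ℝ z (φ n) ^ 2 / (2 * v n))))
        rw [← mul_assoc, ← ENNReal.ofReal_mul (Real.exp_pos _).le, ← Real.exp_add] at h1
        simpa [neg_div] using h1
  refine measure_ball_le_of_forall_lt fun ε' hε' => ?_
  obtain ⟨n, hn⟩ := ((tendsto_norm_tail φ z).eventually_lt_const (sub_pos.2 hε')).exists
  refine le_trans (mul_le_mul' ?_ (measure_mono (Metric.ball_subset_ball' ?_))) (hstep n)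
  · refine ENNReal.ofReal_le_ofReal (Real.exp_le_exp.2 ?_)
    have := hz.sum_le_tsum (Finset.range n) fun k _ => by positivity
    linarith
  · rw [dist_zero_left]; linarith

/-- The upper bound for shifted balls: finitely many coordinates of the centre contribute their
Cameron--Martin factor up to an error that vanishes with the radius, and the remaining ones are
handled by Anderson's inequality. -/
lemma measure_ball_le_exp_mul (φ : HilbertBasis ℕ ℝ X) {μ : Measure X} {v : ℕ → ℝ≥0}
    (hv : ∀ k, v k ≠ 0) (h : ∀ k, HasIndepCoord μ (φ k) (gaussianReal 0 (v k))) (z : X) {ε : ℝ}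
    (hε : 0 ≤ ε) (n : ℕ) :
    μ (Metric.ball z ε) ≤ ENNReal.ofReal
      (Real.exp (-(∑ k ∈ Finset.range n, inner ℝ z (φ k) ^ 2 / v k) / 2 +
        (∑ k ∈ Finset.range n, |inner ℝ z (φ k)| / v k) * ε)) * μ (Metric.ball 0 ε) := by
  suffices hs : μ (Metric.ball z ε) ≤ ENNReal.ofReal
      (Real.exp (-(∑ k ∈ Finset.range n, inner ℝ z (φ k) ^ 2 / v k) / 2 +
        (∑ k ∈ Finset.range n, |inner ℝ z (φ k)| / v k) * ε)) * μ (Metric.ball (tail φ z n) ε) from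
    hs.trans (mul_le_mul_right (measure_ball_le_measure_ball_zero φ hv h _ _) _)
  induction n with
  | zero => simp [tail]
  | succ n ih =>
    refine ih.trans ?_
    have := (h n).measure_ball_le (φ.orthonormal.1 n) (a := inner ℝ z (φ n)) (b := 0)
      hε (fun δ hδ => by
        simpa using gaussianReal_ball_le_exp_mul (hv n) (inner ℝ z (φ n)) hε hδ)
      (inner_tail_succ φ.orthonormal z n)
    rw [zero_smul, add_zero, tail_succ] at this
    refine (mul_le_mul_right this _).trans_eq ?_
    rw [← mul_assoc, ← ENNReal.ofReal_mul (Real.exp_pos _).le, ← Real.exp_add,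
      Finset.sum_range_succ, Finset.sum_range_succ]
    congr 3
    field_simp
    ring

lemma measure_ball_zero_pos (φ : HilbertBasis ℕ ℝ X) {μ : Measure X} [IsProbabilityMeasure μ]
    {v : ℕ → ℝ≥0} (hv : ∀ k, v k ≠ 0)
    (h : ∀ k, HasIndepCoord μ (φ k) (gaussianReal 0 (v k))) {ε : ℝ}
    (hε : 0 < ε) : 0 < μ (Metric.ball 0 ε) := by
  by_contra h0
  have h0 : μ (Metric.ball 0 ε) = 0 := by simpa using h0
  have hU : (⋃ n, Metric.ball (TopologicalSpace.denseSeq X n) ε) = Set.univ :=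
    Set.eq_univ_iff_forall.2 fun x => Set.mem_iUnion.2
      ((TopologicalSpace.denseRange_denseSeq X).exists_dist_lt x hε)
  have h1 : μ Set.univ = 0 := by
    rw [← hU, measure_iUnion_null_iff]
    exact fun n => le_antisymm
      ((measure_ball_le_measure_ball_zero φ hv h _ _).trans h0.le) zero_le
  simp at h1

/-- The small ball asymptotics of a Gaussian measure: the Onsager--Machlup functional of a centred
Gaussian measure is half the square of the Cameron--Martin norm. -/
lemma tendsto_measure_ball_div (φ : HilbertBasis ℕ ℝ X) {μ : Measure X} [IsProbabilityMeasure μ]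
    {v : ℕ → ℝ≥0} (hv : ∀ k, v k ≠ 0)
    (h : ∀ k, HasIndepCoord μ (φ k) (gaussianReal 0 (v k))) {z : X}
    (hz : Summable fun k => inner ℝ z (φ k) ^ 2 / v k) :
    Tendsto (fun ε => μ.real (Metric.ball z ε) / μ.real (Metric.ball 0 ε)) (𝓝[>] 0)
      (𝓝 (Real.exp (-(∑' k, inner ℝ z (φ k) ^ 2 / v k) / 2))) := by
  have hpos : ∀ ε : ℝ, 0 < ε → 0 < μ.real (Metric.ball 0 ε) := fun ε hε =>
    ENNReal.toReal_pos (measure_ball_zero_pos φ hv h hε).ne' (measure_ne_top _ _)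
  refine tendsto_order.2 ⟨fun a ha => ?_, fun a ha => ?_⟩
  · filter_upwards [self_mem_nhdsWithin] with ε (hε : 0 < ε)
    refine ha.trans_le ((le_div_iff₀ (hpos ε hε)).2 ?_)
    have := ENNReal.toReal_mono (measure_ne_top _ _) (exp_mul_measure_ball_zero_le φ hv h hz hε.le)
    rwa [ENNReal.toReal_mul, ENNReal.toReal_ofReal (Real.exp_pos _).le] at this
  · have h1 : Tendsto (fun n => Real.exp (-(∑ k ∈ Finset.range n, inner ℝ z (φ k) ^ 2 / v k) / 2))
        atTop (𝓝 (Real.exp (-(∑' k, inner ℝ z (φ k) ^ 2 / v k) / 2))) :=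
      (Real.continuous_exp.tendsto _).comp (hz.hasSum.tendsto_sum_nat.neg.div_const 2)
    obtain ⟨n, hn⟩ := (h1.eventually_lt_const ha).exists
    have h2 : Tendsto (fun ε : ℝ => Real.exp
        (-(∑ k ∈ Finset.range n, inner ℝ z (φ k) ^ 2 / v k) / 2 +
          (∑ k ∈ Finset.range n, |inner ℝ z (φ k)| / v k) * ε)) (𝓝[>] 0)
        (𝓝 (Real.exp (-(∑ k ∈ Finset.range n, inner ℝ z (φ k) ^ 2 / v k) / 2))) := by
      refine tendsto_nhdsWithin_of_tendsto_nhds ?_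
      refine Continuous.tendsto' (by fun_prop) _ _ (by simp)
    filter_upwards [self_mem_nhdsWithin, h2.eventually_lt_const hn] with ε (hε : 0 < ε) h3
    refine lt_of_le_of_lt ((div_le_iff₀ (hpos ε hε)).2 ?_) h3
    have := ENNReal.toReal_mono (ENNReal.mul_ne_top ENNReal.ofReal_ne_top (measure_ne_top _ _))
      (measure_ball_le_exp_mul φ hv h z hε.le n)
    rwa [ENNReal.toReal_mul, ENNReal.toReal_ofReal (Real.exp_pos _).le] at this

end SmallBall

/-! ### Admissible shifts of a Gaussian measure -/

section CameronMartin

variable {X : Type*} [NormedAddCommGroup X] [InnerProductSpace ℝ X]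
    [SecondCountableTopology X] [MeasurableSpace X] [BorelSpace X]

/-- The Cameron--Martin formula for shifts in finitely many coordinates. -/
lemma lintegral_add_sum_smul_of_gaussian (φ : HilbertBasis ℕ ℝ X) {μ : Measure X} {v : ℕ → ℝ≥0}
    (hv : ∀ k, v k ≠ 0) (h : ∀ k, HasIndepCoord μ (φ k) (gaussianReal 0 (v k))) (t : ℕ → ℝ)
    (n : ℕ) {f : X → ℝ≥0∞} (hf : Measurable f) :
    ∫⁻ x, f (x + ∑ k ∈ Finset.range n, t k • φ k) ∂μ = ∫⁻ x, f x * ENNReal.ofReal (Real.exp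
      (∑ k ∈ Finset.range n, (t k * inner ℝ x (φ k) / v k - t k ^ 2 / (2 * v k)))) ∂μ :=
  lintegral_add_sum_smul φ.orthonormal (w := fun k s => t k * s / v k - t k ^ 2 / (2 * v k))
    (fun k => by fun_prop)
    (fun k f hf => (h k).lintegral_add_smul (φ.orthonormal.1 k)
      (q := fun s => ENNReal.ofReal (Real.exp (t k * s / v k - t k ^ 2 / (2 * v k))))
      (by fun_prop) (fun g hg => lintegral_add_gaussianReal (hv k) (t k) hg) hf) n hf

lemma lintegral_gaussian_density (φ : HilbertBasis ℕ ℝ X) {μ : Measure X} [IsProbabilityMeasure μ]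
    {v : ℕ → ℝ≥0}
    (hv : ∀ k, v k ≠ 0) (h : ∀ k, HasIndepCoord μ (φ k) (gaussianReal 0 (v k))) (t : ℕ → ℝ)
    (n : ℕ) : ∫⁻ x, ENNReal.ofReal (Real.exp
      (∑ k ∈ Finset.range n, (t k * inner ℝ x (φ k) / v k - t k ^ 2 / (2 * v k)))) ∂μ = 1 := by
  simpa using (lintegral_add_sum_smul_of_gaussian φ hv h t n (f := 1) measurable_one).symm

/-- The densities of the finite-dimensional shifts are bounded in `L²`, hence the shifted measures
are uniformly absolutely continuous on open sets; outer regularity passes from open to Borel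
sets. -/
lemma map_add_absolutelyContinuous (φ : HilbertBasis ℕ ℝ X) {μ : Measure X}
    [IsProbabilityMeasure μ] {v : ℕ → ℝ≥0}
    (hv : ∀ k, v k ≠ 0) (h : ∀ k, HasIndepCoord μ (φ k) (gaussianReal 0 (v k))) {z : X}
    (hz : Summable fun k => inner ℝ z (φ k) ^ 2 / v k) : μ.map (fun x => x + z) ≪ μ := by
  set S := ∑' k, inner ℝ z (φ k) ^ 2 / v k with hS
  let ℓ : (ℕ → ℝ) → ℕ → X → ℝ := fun t n x =>
    ∑ k ∈ Finset.range n, (t k * inner ℝ x (φ k) / v k - t k ^ 2 / (2 * v k))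
  have hℓm : ∀ t n, Measurable (ℓ t n) := fun t n => by
    refine Finset.measurable_fun_sum _ fun k _ => ?_
    fun_prop
  let t : ℕ → ℝ := fun k => inner ℝ z (φ k)
  have hL2 : ∀ n, ∫⁻ x, ENNReal.ofReal (Real.exp (ℓ t n x) ^ 2) ∂μ ≤
      ENNReal.ofReal (Real.exp S) := by
    intro n
    calc _ ≤ ∫⁻ x, ENNReal.ofReal (Real.exp S) *
          ENNReal.ofReal (Real.exp (ℓ (fun k => 2 * t k) n x)) ∂μ := by
          refine lintegral_mono fun x => ?_
          rw [← ENNReal.ofReal_mul (Real.exp_pos _).le, ← Real.exp_add, ← Real.exp_nat_mul]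
          refine ENNReal.ofReal_le_ofReal (Real.exp_le_exp.2 ?_)
          have h1 : ((2 : ℕ) : ℝ) * ℓ t n x = ℓ (fun k => 2 * t k) n x +
              ∑ k ∈ Finset.range n, t k ^ 2 / v k := by
            simp only [ℓ]
            rw [Finset.mul_sum, ← Finset.sum_add_distrib]
            refine Finset.sum_congr rfl fun k _ => ?_
            have : (v k : ℝ) ≠ 0 := by exact_mod_cast hv k
            field_simp
            push_cast
            ring
          have := hz.sum_le_tsum (Finset.range n) fun k _ => by positivity
          rw [h1]
          linarith
      _ = _ := by
          rw [lintegral_const_mul _ (by fun_prop),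
            lintegral_gaussian_density φ hv h (fun k => 2 * t k) n, mul_one]
  have hopen : ∀ δ : ℝ, 0 < δ → ∀ G : Set X, IsOpen G → μ.map (fun x => x + z) G ≤
      ENNReal.ofReal δ * ENNReal.ofReal (Real.exp S) + ENNReal.ofReal δ⁻¹ * μ G := by
    intro δ hδ G hG
    have hGm : Measurable (G.indicator (1 : X → ℝ≥0∞)) :=
      measurable_one.indicator hG.measurableSet
    rw [← lintegral_indicator_one hG.measurableSet, lintegral_map hGm (by fun_prop)]
    calc ∫⁻ x, G.indicator 1 (x + z) ∂μ
        ≤ ∫⁻ x, liminf (fun n => G.indicator (1 : X → ℝ≥0∞)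
            (x + ∑ k ∈ Finset.range n, t k • φ k)) atTop ∂μ := by
          refine lintegral_mono fun x => ?_
          by_cases hx : x + z ∈ G
          · refine le_liminf_of_le (by isBoundedDefault) ?_
            have := (tendsto_const_nhds (x := x)).add (hasSum_inner_smul φ z).tendsto_sum_nat
            filter_upwards [this.eventually_mem (hG.mem_nhds hx)] with n hn
            rw [Set.indicator_of_mem hx, Set.indicator_of_mem hn]
            rfl
          · rw [Set.indicator_of_notMem hx]; exact zero_le
      _ ≤ liminf (fun n => ∫⁻ x, G.indicator (1 : X → ℝ≥0∞)
            (x + ∑ k ∈ Finset.range n, t k • φ k) ∂μ) atTop :=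
          lintegral_liminf_le fun n => hGm.comp (by fun_prop)
      _ ≤ _ := by
          refine liminf_le_of_frequently_le' (Frequently.of_forall fun n => ?_)
          rw [lintegral_add_sum_smul_of_gaussian φ hv h t n hGm]
          calc _ ≤ ∫⁻ x, (ENNReal.ofReal δ * ENNReal.ofReal (Real.exp (ℓ t n x) ^ 2) +
                ENNReal.ofReal δ⁻¹ * G.indicator (1 : X → ℝ≥0∞) x) ∂μ := by
                refine lintegral_mono fun x => ?_
                by_cases hx : x ∈ G
                · simp only [Set.indicator_of_mem hx, Pi.one_apply, one_mul, mul_one]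
                  rw [← ENNReal.ofReal_mul hδ.le, ← ENNReal.ofReal_add (by positivity)
                    (by positivity)]
                  refine ENNReal.ofReal_le_ofReal ?_
                  change Real.exp (ℓ t n x) ≤ _
                  have h1 : 0 < Real.exp (ℓ t n x) := Real.exp_pos _
                  -- `D ≤ δ D² + δ⁻¹` by completing the square
                  have h2 : δ * Real.exp (ℓ t n x) ^ 2 + δ⁻¹ - Real.exp (ℓ t n x) =
                      δ * (Real.exp (ℓ t n x) - δ⁻¹ / 2) ^ 2 + 3 / 4 * δ⁻¹ := by
                    field_simp; ring
                  have h3 : 0 ≤ δ * (Real.exp (ℓ t n x) - δ⁻¹ / 2) ^ 2 + 3 / 4 * δ⁻¹ := by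
                    positivity
                  linarith
                · simp [Set.indicator_of_notMem hx]
            _ = ENNReal.ofReal δ * ∫⁻ x, ENNReal.ofReal (Real.exp (ℓ t n x) ^ 2) ∂μ +
                  ENNReal.ofReal δ⁻¹ * μ G := by
                rw [lintegral_add_left (by fun_prop), lintegral_const_mul _ (by fun_prop),
                  lintegral_const_mul _ hGm, lintegral_indicator_one hG.measurableSet]
            _ ≤ _ := by gcongr; exact hL2 n
  intro A hA
  have hle : ∀ δ : ℝ, 0 < δ → μ.map (fun x => x + z) A ≤
      ENNReal.ofReal δ * (ENNReal.ofReal (Real.exp S) + 1) := by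
    intro δ hδ
    obtain ⟨G, hAG, hG, hμG⟩ := A.exists_isOpen_lt_of_lt (μ := μ) (ENNReal.ofReal (δ ^ 2))
      (by rw [hA]; simpa using by positivity)
    refine (measure_mono hAG).trans ((hopen δ hδ G hG).trans ?_)
    rw [mul_add]
    refine add_le_add le_rfl ((mul_le_mul_right hμG.le _).trans_eq ?_)
    rw [← ENNReal.ofReal_mul (by positivity), mul_one]
    congr 1
    field_simp
  have hlim : Tendsto (fun δ : ℝ => ENNReal.ofReal δ * (ENNReal.ofReal (Real.exp S) + 1))
      (𝓝[>] 0) (𝓝 0) := by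
    have h1 : Tendsto (fun δ : ℝ => ENNReal.ofReal δ) (𝓝[>] 0) (𝓝 0) :=
      tendsto_nhdsWithin_of_tendsto_nhds (ENNReal.continuous_ofReal.tendsto' _ _ (by simp))
    have h2 : ENNReal.ofReal (Real.exp S) + 1 ≠ ∞ := by finiteness
    have h3 := ENNReal.Tendsto.mul_const h1 (Or.inr h2)
    rwa [zero_mul] at h3
  refine le_antisymm (ge_of_tendsto hlim ?_) zero_le
  filter_upwards [self_mem_nhdsWithin] with δ hδ using hle δ hδ

/-- Outside the Cameron--Martin space the shifted measure is not absolutely continuous: the sets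
where the density of the finite-dimensional shift is at least `1` get small for `μ` and large for
the shifted measure, because the Hellinger integrals `∫ √D_n ∂μ = exp (-S_n / 8)` vanish. -/
lemma summable_of_map_add_absolutelyContinuous (φ : HilbertBasis ℕ ℝ X) {μ : Measure X}
    [IsProbabilityMeasure μ] {v : ℕ → ℝ≥0}
    (hv : ∀ k, v k ≠ 0) (h : ∀ k, HasIndepCoord μ (φ k) (gaussianReal 0 (v k))) {z : X}
    (hz : μ.map (fun x => x + z) ≪ μ) : Summable fun k => inner ℝ z (φ k) ^ 2 / v k := by
  by_contra hns
  have hS := (not_summable_iff_tendsto_nat_atTop_of_nonneg fun k => by positivity).1 hns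
  let t : ℕ → ℝ := fun k => inner ℝ z (φ k)
  let ℓ : (ℕ → ℝ) → ℕ → X → ℝ := fun t n x =>
    ∑ k ∈ Finset.range n, (t k * inner ℝ x (φ k) / v k - t k ^ 2 / (2 * v k))
  have hℓm : ∀ t n, Measurable (ℓ t n) := fun t n => by
    refine Finset.measurable_fun_sum _ fun k _ => ?_
    fun_prop
  let c : ℕ → ℝ≥0∞ := fun n =>
    ENNReal.ofReal (Real.exp (-(∑ k ∈ Finset.range n, t k ^ 2 / v k) / 8))
  have hc : Tendsto c atTop (𝓝 0) := by
    rw [← ENNReal.ofReal_zero]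
    refine (ENNReal.continuous_ofReal.tendsto _).comp (Real.tendsto_exp_atBot.comp ?_)
    simp_rw [neg_div]
    exact tendsto_neg_atTop_atBot.comp (hS.atTop_div_const (by norm_num))
  have hH : ∀ n, ∫⁻ x, ENNReal.ofReal (Real.exp (ℓ t n x / 2)) ∂μ = c n := by
    intro n
    have h1 : ∀ x, ENNReal.ofReal (Real.exp (ℓ t n x / 2)) =
        c n * ENNReal.ofReal (Real.exp (ℓ (fun k => t k / 2) n x)) := by
      intro x
      simp only [c]
      rw [← ENNReal.ofReal_mul (Real.exp_pos _).le, ← Real.exp_add]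
      congr 2
      simp only [ℓ]
      rw [Finset.sum_div, neg_div, Finset.sum_div, ← Finset.sum_neg_distrib,
        ← Finset.sum_add_distrib]
      refine Finset.sum_congr rfl fun k _ => ?_
      have : (v k : ℝ) ≠ 0 := by exact_mod_cast hv k
      field_simp
      ring
    simp_rw [h1]
    rw [lintegral_const_mul _ (by fun_prop),
      lintegral_gaussian_density φ hv h (fun k => t k / 2) n, mul_one]
  let A : ℕ → Set X := fun n => {x | 0 ≤ ℓ t n x}
  have hA : ∀ n, MeasurableSet (A n) := fun n => measurableSet_le measurable_const (hℓm t n)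
  have h1 : ∀ n, μ (A n) ≤ c n := by
    intro n
    rw [← hH n, ← lintegral_indicator_one (hA n)]
    refine lintegral_mono fun x => ?_
    by_cases hx : x ∈ A n
    · rw [Set.indicator_of_mem hx, Pi.one_apply, ENNReal.one_le_ofReal]
      exact Real.one_le_exp (div_nonneg hx (by norm_num))
    · rw [Set.indicator_of_notMem hx]; exact zero_le
  have h2 : ∀ n, μ.map (fun x => x + z) (A n)ᶜ ≤ c n := by
    intro n
    have hm : Measurable ((A n)ᶜ.indicator (1 : X → ℝ≥0∞)) := measurable_one.indicator (hA n).compl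
    rw [← lintegral_indicator_one (hA n).compl, lintegral_map hm (by fun_prop), ← hH n]
    calc _ = ∫⁻ x, (A n)ᶜ.indicator 1 (x + ∑ k ∈ Finset.range n, t k • φ k) ∂μ := by
          -- membership in `A n` depends on the first `n` coordinates only
          congr 1 with x
          have : ℓ t n (x + z) = ℓ t n (x + ∑ k ∈ Finset.range n, t k • φ k) := by
            refine Finset.sum_congr rfl fun k hk => ?_
            congr 3
            simp only [inner_add_left, sum_inner, inner_smul_left,
              orthonormal_iff_ite.1 φ.orthonormal]
            simp [Finset.mem_range.1 hk, t]
          simp only [Set.indicator_apply, Set.mem_compl_iff, A, Set.mem_ofPred_eq, this]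
          rfl
      _ = _ := lintegral_add_sum_smul_of_gaussian φ hv h t n hm
      _ ≤ _ := by
          refine lintegral_mono fun x => ?_
          by_cases hx : x ∈ (A n)ᶜ
          · have hx' : ℓ t n x < 0 := not_le.1 hx
            rw [Set.indicator_of_mem hx, Pi.one_apply, one_mul]
            refine ENNReal.ofReal_le_ofReal (Real.exp_le_exp.2 ?_)
            change ℓ t n x ≤ ℓ t n x / 2
            linarith
          · simp [Set.indicator_of_notMem hx]
  have hprob : IsProbabilityMeasure (μ.map fun x => x + z) :=
    Measure.isProbabilityMeasure_map (by fun_prop)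
  have h3 : Tendsto (fun n => μ.map (fun x => x + z) (A n)) atTop (𝓝 0) := by
    have hlt : ∫⁻ x, (μ.map fun x => x + z).rnDeriv μ x ∂μ ≠ ∞ :=
      (Measure.lintegral_rnDeriv_lt_top _ _).ne
    have := tendsto_setLIntegral_zero hlt
      (tendsto_of_tendsto_of_tendsto_of_le_of_le tendsto_const_nhds hc (fun _ => zero_le) h1)
    refine this.congr fun n => ?_
    rw [← withDensity_apply _ (hA n), Measure.withDensity_rnDeriv_eq _ _ hz]
  have h4 := h3.add
    (tendsto_of_tendsto_of_tendsto_of_le_of_le tendsto_const_nhds hc (fun _ => zero_le) h2)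
  have h5 : ∀ n, μ.map (fun x => x + z) (A n) + μ.map (fun x => x + z) (A n)ᶜ = 1 := fun n =>
    prob_add_prob_compl (hA n)
  simp only [h5] at h4
  have := tendsto_nhds_unique h4 tendsto_const_nhds
  simp at this

/-- The admissible shifts of a measure that is equivalent to a Gaussian measure form the
Cameron--Martin space. -/
lemma admissibleShifts_eq (φ : HilbertBasis ℕ ℝ X) {μ ν : Measure X}
    [IsProbabilityMeasure μ] (hνμ : ν ≪ μ) (hμν : μ ≪ ν) {v : ℕ → ℝ≥0}
    (hv : ∀ k, v k ≠ 0) (h : ∀ k, HasIndepCoord μ (φ k) (gaussianReal 0 (v k))) :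
    admissibleShifts ν = {z | Summable fun k => inner ℝ z (φ k) ^ 2 / v k} := by
  ext z
  simp only [admissibleShifts, shift, Set.mem_ofPred_eq]
  have hm : ∀ z : X, Measurable fun x => x + z := fun z => by fun_prop
  constructor
  · rintro ⟨h1, -⟩
    exact summable_of_map_add_absolutelyContinuous φ hv h
      (((hμν.map (hm z)).trans h1).trans hνμ)
  · intro hz
    have hz' : Summable fun k => inner ℝ (-z) (φ k) ^ 2 / v k := by simpa using hz
    refine ⟨((hνμ.map (hm z)).trans (map_add_absolutelyContinuous φ hv h hz)).trans hμν,
      (hνμ.trans ?_).trans (hμν.map (hm z))⟩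
    have := (map_add_absolutelyContinuous φ hv h hz').map (hm z)
    rw [Measure.map_map (hm z) (hm _)] at this
    simpa [Function.comp_def] using this

end CameronMartin

/-! ### Small balls under a change of density -/

lemma tendsto_withDensity_ball_div {X : Type*} [PseudoMetricSpace X] [MeasurableSpace X]
    [OpensMeasurableSpace X] {μ : Measure X} [IsFiniteMeasure μ] {D : X → ℝ} (hD : Continuous D)
    (hD0 : ∀ x, 0 ≤ D x) {z : X} (hz : ∀ ε : ℝ, 0 < ε → 0 < μ.real (Metric.ball z ε)) :
    Tendsto (fun ε => (μ.withDensity fun x => ENNReal.ofReal (D x)).real (Metric.ball z ε) /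
      μ.real (Metric.ball z ε)) (𝓝[>] 0) (𝓝 (D z)) := by
  refine Metric.tendsto_nhds.2 fun δ hδ => ?_
  obtain ⟨ε₀, hε₀, h⟩ := Metric.continuousAt_iff.1 hD.continuousAt (δ / 2) (half_pos hδ)
  filter_upwards [Ioo_mem_nhdsGT hε₀] with ε hε
  have hin : ∀ x ∈ Metric.ball z ε, |D x - D z| < δ / 2 := fun x hx =>
    h (lt_trans (Metric.mem_ball.1 hx) hε.2)
  have hup : (μ.withDensity fun x => ENNReal.ofReal (D x)) (Metric.ball z ε) ≤
      ENNReal.ofReal (D z + δ / 2) * μ (Metric.ball z ε) := by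
    rw [withDensity_apply _ measurableSet_ball, ← setLIntegral_const]
    exact setLIntegral_mono' measurableSet_ball fun x hx =>
      ENNReal.ofReal_le_ofReal (by linarith [(abs_lt.1 (hin x hx)).2])
  have hlo : ENNReal.ofReal (D z - δ / 2) * μ (Metric.ball z ε) ≤
      (μ.withDensity fun x => ENNReal.ofReal (D x)) (Metric.ball z ε) := by
    rw [withDensity_apply _ measurableSet_ball, ← setLIntegral_const]
    exact setLIntegral_mono' measurableSet_ball fun x hx =>
      ENNReal.ofReal_le_ofReal (by linarith [(abs_lt.1 (hin x hx)).1])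
  have htop : ENNReal.ofReal (D z + δ / 2) * μ (Metric.ball z ε) ≠ ∞ :=
    ENNReal.mul_ne_top ENNReal.ofReal_ne_top (measure_ne_top _ _)
  have hup' := ENNReal.toReal_mono htop hup
  have hlo' := ENNReal.toReal_mono (ne_top_of_le_ne_top htop hup) hlo
  rw [ENNReal.toReal_mul, ENNReal.toReal_ofReal (by linarith [hD0 z])] at hup'
  rw [ENNReal.toReal_mul, ENNReal.toReal_ofReal'] at hlo'
  have hpos := hz ε hε.1
  rw [Real.dist_eq, abs_lt]
  constructor
  · have : D z - δ / 2 ≤ (μ.withDensity fun x => ENNReal.ofReal (D x)).real (Metric.ball z ε) /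
        μ.real (Metric.ball z ε) := by
      rw [le_div_iff₀ hpos]
      exact (mul_le_mul_of_nonneg_right (le_max_left _ _) hpos.le).trans hlo'
    linarith
  · have : (μ.withDensity fun x => ENNReal.ofReal (D x)).real (Metric.ball z ε) /
        μ.real (Metric.ball z ε) ≤ D z + δ / 2 := (div_le_iff₀ hpos).2 hup'
    linarith

/-! ### Bayes' formula -/

/-- Bayes' formula for additive noise: if the translates of the noise distribution `ν` by `K x`
have densities `w x` with respect to `ν`, then the measures with prior density proportional to
`w · y` form a regular conditional distribution of the unknown given the data. -/
lemma isRegularCondDistrib_of_lintegral_add {X Y : Type*} [MeasurableSpace X] [MeasurableSpace Y]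
    [Add Y] [MeasurableAdd₂ Y] {Ω : Type*} [MeasurableSpace Ω] {P : Measure Ω}
    [IsProbabilityMeasure P] {u : Ω → X} {η : Ω → Y} (hu : Measurable u) (hη : Measurable η)
    (hindep : IndepFun u η P) {K : X → Y} (hK : Measurable K) {w : X → Y → ℝ≥0∞}
    (hw : Measurable (Function.uncurry w))
    (hshift : ∀ x, ∀ f : Y → ℝ≥0∞, Measurable f →
      ∫⁻ y, f (y + K x) ∂(P.map η) = ∫⁻ y, f y * w x y ∂(P.map η))
    (hZ0 : ∀ y, ∫⁻ x, w x y ∂(P.map u) ≠ 0) (hZtop : ∀ y, ∫⁻ x, w x y ∂(P.map u) ≠ ∞) :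
    IsRegularCondDistrib P u (fun ω => η ω + K (u ω))
      (fun y => (∫⁻ x, w x y ∂(P.map u))⁻¹ • (P.map u).withDensity fun x => w x y) := by
  have hpu : IsProbabilityMeasure (P.map u) := Measure.isProbabilityMeasure_map hu.aemeasurable
  have hpη : IsProbabilityMeasure (P.map η) := Measure.isProbabilityMeasure_map hη.aemeasurable
  have hZm : Measurable fun y => ∫⁻ x, w x y ∂(P.map u) :=
    (hw.comp measurable_swap).lintegral_prod_right'
  have hBm : ∀ B : Set X, Measurable fun y => ∫⁻ x in B, w x y ∂(P.map u) := fun B =>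
    (hw.comp measurable_swap).lintegral_prod_right'
  have happ : ∀ (B : Set X), MeasurableSet B → ∀ y,
      ((∫⁻ x, w x y ∂(P.map u))⁻¹ • (P.map u).withDensity fun x => w x y) B =
        (∫⁻ x, w x y ∂(P.map u))⁻¹ * ∫⁻ x in B, w x y ∂(P.map u) := fun B hB y => by
    rw [Measure.smul_apply, withDensity_apply _ hB, smul_eq_mul]
  have hYm : Measurable fun ω => η ω + K (u ω) := hη.add (hK.comp hu)
  have hjoint : ∀ (B : Set X) (C : Set Y), MeasurableSet B → MeasurableSet C →
      P (u ⁻¹' B ∩ (fun ω => η ω + K (u ω)) ⁻¹' C) =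
        ∫⁻ y in C, ∫⁻ x in B, w x y ∂(P.map u) ∂(P.map η) := by
    intro B C hB hC
    have hBC : MeasurableSet {p : X × Y | p.1 ∈ B ∧ p.2 + K p.1 ∈ C} :=
      (measurable_fst hB).inter ((measurable_snd.add (hK.comp measurable_fst)) hC)
    have hCm : Measurable (C.indicator (1 : Y → ℝ≥0∞)) := measurable_one.indicator hC
    calc _ = P.map (fun ω => (u ω, η ω)) {p : X × Y | p.1 ∈ B ∧ p.2 + K p.1 ∈ C} := by
          rw [Measure.map_apply (hu.prodMk hη) hBC]; rfl
      _ = ∫⁻ x, ∫⁻ y, {p : X × Y | p.1 ∈ B ∧ p.2 + K p.1 ∈ C}.indicator 1 (x, y)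
            ∂(P.map η) ∂(P.map u) := by
          rw [(indepFun_iff_map_prod_eq_prod_map_map hu.aemeasurable hη.aemeasurable).1 hindep,
            ← lintegral_indicator_one hBC,
            lintegral_prod _ (measurable_one.indicator hBC).aemeasurable]
      _ = ∫⁻ x in B, ∫⁻ y in C, w x y ∂(P.map η) ∂(P.map u) := by
          rw [← lintegral_indicator hB]
          congr 1 with x
          by_cases hx : x ∈ B
          · rw [Set.indicator_of_mem hx, ← lintegral_indicator hC]
            calc _ = ∫⁻ y, C.indicator (1 : Y → ℝ≥0∞) (y + K x) ∂(P.map η) := by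
                  congr 1 with y
                  by_cases hy : y + K x ∈ C
                  · rw [Set.indicator_of_mem hy, Set.indicator_of_mem (by exact ⟨hx, hy⟩)]
                    rfl
                  · rw [Set.indicator_of_notMem hy, Set.indicator_of_notMem fun h => hy h.2]
              _ = _ := hshift x _ hCm
              _ = _ := by
                  congr 1 with y
                  by_cases hy : y ∈ C
                  · simp [Set.indicator_of_mem hy]
                  · simp [Set.indicator_of_notMem hy]
          · rw [Set.indicator_of_notMem hx]
            refine (lintegral_congr fun y => Set.indicator_of_notMem (fun h => hx h.1) _).trans ?_
            exact lintegral_zero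
      _ = _ := lintegral_lintegral_swap hw.aemeasurable
  have hlaw : P.map (fun ω => η ω + K (u ω)) =
      (P.map η).withDensity fun y => ∫⁻ x, w x y ∂(P.map u) := by
    ext C hC
    rw [Measure.map_apply hYm hC, withDensity_apply _ hC]
    simpa using hjoint Set.univ C .univ hC
  refine ⟨fun y => ⟨?_⟩, fun B hB => ?_, fun B C hB hC => ?_⟩
  · rw [happ _ .univ, setLIntegral_univ, ENNReal.inv_mul_cancel (hZ0 y) (hZtop y)]
  · simp_rw [happ B hB]
    exact hZm.inv.mul (hBm B)
  · simp_rw [happ B hB]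
    rw [hjoint B C hB hC, hlaw, setLIntegral_withDensity_eq_setLIntegral_mul _ hZm
      (g := fun y => (∫⁻ x, w x y ∂(P.map u))⁻¹ * ∫⁻ x in B, w x y ∂(P.map u))
      (hZm.inv.mul (hBm B)) hC]
    refine lintegral_congr fun y => ?_
    simp only [Pi.mul_apply]
    rw [← mul_assoc, ENNReal.mul_inv_cancel (hZ0 y) (hZtop y), one_mul]

/-! ### Diagonal operators -/

section Diagonal

variable {X : Type*} [NormedAddCommGroup X] [InnerProductSpace ℝ X]

/-- Every square-summable sequence is the sequence of coordinates of a vector. -/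
lemma exists_hasSum_smul_of_summable_sq (φ : HilbertBasis ℕ ℝ X) {c : ℕ → ℝ}
    (hc : Summable fun k => c k ^ 2) :
    ∃ x : X, HasSum (fun k => c k • φ k) x ∧ ∀ k, inner ℝ x (φ k) = c k := by
  have hmem : Memℓp c 2 := memℓp_gen (by simpa using hc)
  let f : lp (fun _ : ℕ => ℝ) 2 := ⟨c, hmem⟩
  refine ⟨φ.repr.symm f, φ.hasSum_repr_symm f, fun k => ?_⟩
  rw [real_inner_comm, ← φ.repr_apply_apply, LinearIsometryEquiv.apply_symm_apply]

lemma hasSum_inner_sq (φ : HilbertBasis ℕ ℝ X) (x : X) :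
    HasSum (fun k => inner ℝ x (φ k) ^ 2) (‖x‖ ^ 2) := by
  have := φ.hasSum_inner_mul_inner x x
  rw [real_inner_self_eq_norm_sq] at this
  refine this.congr_fun fun k => ?_
  rw [real_inner_comm x, sq]

lemma abs_inner_basis_le (φ : HilbertBasis ℕ ℝ X) (x : X) (k : ℕ) : |inner ℝ x (φ k)| ≤ ‖x‖ := by
  simpa [φ.orthonormal.1 k] using abs_real_inner_le_norm x (φ k)

lemma powA_basis (φ : HilbertBasis ℕ ℝ X) (α : ℕ → ℝ) (s : ℝ) (k : ℕ) :
    powA φ α s (φ k) = α k ^ s • φ k := by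
  rw [powA, tsum_eq_single k]
  · simp [φ.orthonormal.1 k]
  · intro j hj
    simp [φ.orthonormal.2 hj.symm]

lemma powA_spec (φ : HilbertBasis ℕ ℝ X) {α : ℕ → ℝ} {s : ℝ} {x : X}
    (h : Summable fun k => (α k ^ s * inner ℝ x (φ k)) ^ 2) (k : ℕ) :
    inner ℝ (powA φ α s x) (φ k) = α k ^ s * inner ℝ x (φ k) := by
  obtain ⟨z, hz, hz'⟩ := exists_hasSum_smul_of_summable_sq φ h
  rw [powA, hz.tsum_eq, hz']

variable {φ : HilbertBasis ℕ ℝ X} {α : ℕ → ℝ}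

lemma rpow_half_mul_sq {a : ℝ} (ha : 0 < a) (s x : ℝ) : (a ^ (s / 2) * x) ^ 2 = a ^ s * |x| ^ 2 := by
  rw [mul_pow, ← Real.rpow_natCast, ← Real.rpow_mul ha.le, sq_abs]
  congr 2
  push_cast; ring

lemma mem_scaleSpace_iff {s : ℝ} {x : X} :
    x ∈ scaleSpace φ α s ↔ Summable fun k => α k ^ s * |inner ℝ x (φ k)| ^ 2 := by
  simp only [scaleSpace, domPow, Set.mem_ofPred_eq]
  rw [mul_div_cancel₀ s two_ne_zero]

lemma scaleNorm_sq (hα : ∀ k, 0 < α k) {s : ℝ} {x : X} (hx : x ∈ scaleSpace φ α s) :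
    scaleNorm φ α s x ^ 2 = ∑' k, α k ^ s * |inner ℝ x (φ k)| ^ 2 := by
  rw [mem_scaleSpace_iff] at hx
  have hx' : Summable fun k => (α k ^ (s / 2) * inner ℝ x (φ k)) ^ 2 := by
    simpa only [rpow_half_mul_sq (hα _)] using hx
  rw [scaleNorm, ← (hasSum_inner_sq φ _).tsum_eq]
  exact tsum_congr fun k => by rw [powA_spec φ hx', rpow_half_mul_sq (hα k)]

/-- The space `X^s` is the range of `A^{-s/2}`, since `A^{-s/2}` is bounded. -/
lemma scaleSpace_eq_range {a : ℝ} (ha : 0 < a) (hα : ∀ k, a ≤ α k) {s : ℝ} (hs : 0 ≤ s) :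
    scaleSpace φ α s = Set.range (powA φ α (-s / 2)) := by
  have hpos : ∀ k, 0 < α k := fun k => ha.trans_le (hα k)
  ext x
  rw [mem_scaleSpace_iff]
  constructor
  · intro hx
    have hx' : Summable fun k => (α k ^ (s / 2) * inner ℝ x (φ k)) ^ 2 := by
      simpa only [rpow_half_mul_sq (hpos _)] using hx
    obtain ⟨z, -, hz⟩ := exists_hasSum_smul_of_summable_sq φ hx'
    refine ⟨z, ?_⟩
    rw [powA, ← (hasSum_inner_smul φ x).tsum_eq]
    refine tsum_congr fun k => ?_
    rw [hz, ← mul_assoc, ← Real.rpow_add (hpos k)]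
    simp [neg_div]
  · rintro ⟨z, rfl⟩
    have hz : Summable fun k => (α k ^ (-s / 2) * inner ℝ z (φ k)) ^ 2 := by
      refine Summable.of_nonneg_of_le (fun k => sq_nonneg _) (fun k => ?_)
        ((hasSum_inner_sq φ z).summable.mul_left (a ^ (-s)))
      rw [rpow_half_mul_sq (hpos k), sq_abs]
      exact mul_le_mul_of_nonneg_right
        (Real.rpow_le_rpow_of_nonpos ha (hα k) (by linarith)) (sq_nonneg _)
    refine (hasSum_inner_sq φ z).summable.congr fun k => ?_
    rw [powA_spec φ hz, ← rpow_half_mul_sq (hpos k), ← mul_assoc, ← Real.rpow_add (hpos k)]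
    simp [neg_div]

/-- Since `α_k` grows at least like a power of `k`, the factor `exp (-q α_k)` makes every power of
`α_k` summable. -/
lemma summable_rpow_mul_exp_neg {d c : ℝ} (hd : 0 < d) (hc : 0 < c)
    (hα : ∀ k : ℕ, c * ((k : ℝ) + 1) ^ (2 / d) ≤ α k) (p : ℝ) {q : ℝ} (hq : 0 < q) :
    Summable fun k => α k ^ p * Real.exp (-q * α k) := by
  have hk : Tendsto (fun k : ℕ => (k : ℝ) + 1) atTop atTop :=
    tendsto_atTop_add_const_right _ _ tendsto_natCast_atTop_atTop
  have hlim : Tendsto α atTop atTop :=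
    tendsto_atTop_mono hα (((tendsto_rpow_atTop (by positivity)).comp hk).const_mul_atTop hc)
  have h1 := (tendsto_rpow_mul_exp_neg_mul_atTop_nhds_zero (p + d) q hq).comp hlim
  have hsum : Summable fun k : ℕ => c ^ (-d) * (1 / ((k : ℝ) + 1) ^ 2) := by
    refine Summable.mul_left _ ?_
    have := (summable_nat_add_iff 1).2 (Real.summable_one_div_nat_pow.2 (one_lt_two))
    exact_mod_cast this
  refine summable_of_isBigO_nat hsum (Asymptotics.IsBigO.of_bound 1 ?_)
  filter_upwards [h1.eventually_le_const one_pos] with k hk1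
  have hb : 0 < c * ((k : ℝ) + 1) ^ (2 / d) := by positivity
  have hpos : 0 < α k := hb.trans_le (hα k)
  rw [Real.norm_of_nonneg (by positivity), Real.norm_of_nonneg (by positivity), one_mul]
  calc α k ^ p * Real.exp (-q * α k)
      = (α k ^ (p + d) * Real.exp (-q * α k)) * α k ^ (-d) := by
        rw [mul_right_comm, ← Real.rpow_add hpos]; simp
    _ ≤ 1 * α k ^ (-d) := by
        refine mul_le_mul_of_nonneg_right hk1 (by positivity)
    _ ≤ (c * ((k : ℝ) + 1) ^ (2 / d)) ^ (-d) := by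
        rw [one_mul]
        exact Real.rpow_le_rpow_of_nonpos hb (hα k) (by linarith)
    _ = _ := by
        rw [Real.mul_rpow hc.le (by positivity), ← Real.rpow_mul (by positivity)]
        congr 1
        rw [show 2 / d * -d = -(2 : ℕ) by field_simp; norm_num, Real.rpow_neg (by positivity),
          Real.rpow_natCast, one_div]

end Diagonal

/-! ### The negative log-likelihood -/

section Likelihood

variable {X : Type*} [NormedAddCommGroup X] [InnerProductSpace ℝ X]
variable {φ : HilbertBasis ℕ ℝ X} {α : ℕ → ℝ} {b β : ℝ}

lemma negLogLik_term_eq (hα : ∀ k, 0 < α k) (s : ℝ) (k : ℕ) :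
    s / (b * α k ^ (-β / 2)) = b⁻¹ * (α k ^ (β / 2) * s) := by
  rw [neg_div, Real.rpow_neg (hα k).le, mul_comm b, div_mul_eq_div_div, div_inv_eq_mul]
  ring

lemma negLogLik_eq (hα : ∀ k, 0 < α k) (u y : X) :
    negLogLik φ α b β u y = √2 / b * ∑' k, α k ^ (β / 2) *
      (|inner ℝ y (φ k) - Real.exp (-α k) * inner ℝ u (φ k)| - |inner ℝ y (φ k)|) := by
  simp_rw [negLogLik, negLogLik_term_eq hα, tsum_mul_left]
  ring

lemma abs_weighted_sub_le {a E y s t : ℝ} (ha : 0 < a) (hE : 0 ≤ E) :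
    |a ^ (β / 2) * (|y - E * s| - |y|) - a ^ (β / 2) * (|y - E * t| - |y|)| ≤
      a ^ (β / 2) * E * |s - t| := by
  have hp : 0 < a ^ (β / 2) := Real.rpow_pos_of_pos ha _
  rw [← mul_sub, sub_sub_sub_cancel_right, abs_mul, abs_of_pos hp, mul_assoc]
  refine mul_le_mul_of_nonneg_left ((abs_abs_sub_abs_le _ _).trans_eq ?_) hp.le
  rw [← abs_of_nonneg hE, ← abs_mul, abs_of_nonneg hE, ← abs_neg]
  congr 1
  ring

lemma summable_likelihood (hα : ∀ k, 0 < α k)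
    (hsum : Summable fun k => α k ^ (β / 2) * Real.exp (-α k)) (u y : X) :
    Summable fun k => α k ^ (β / 2) *
      (|inner ℝ y (φ k) - Real.exp (-α k) * inner ℝ u (φ k)| - |inner ℝ y (φ k)|) := by
  refine Summable.of_norm_bounded (hsum.mul_right ‖u‖) fun k => ?_
  have h := abs_weighted_sub_le (β := β) (y := inner ℝ y (φ k)) (s := inner ℝ u (φ k)) (t := 0)
    (hα k) (Real.exp_pos (-α k)).le
  simp only [mul_zero, sub_zero, sub_self] at h
  have := hα k
  exact h.trans (mul_le_mul_of_nonneg_left (abs_inner_basis_le φ u k) (by positivity))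

/-- The negative log-likelihood is Lipschitz in the unknown, uniformly in the data. -/
lemma abs_negLogLik_sub_le (hα : ∀ k, 0 < α k) (hb : 0 < b)
    (hsum : Summable fun k => α k ^ (β / 2) * Real.exp (-α k)) (u v y : X) :
    |negLogLik φ α b β u y - negLogLik φ α b β v y| ≤
      √2 / b * (∑' k, α k ^ (β / 2) * Real.exp (-α k)) * ‖u - v‖ := by
  rw [negLogLik_eq hα, negLogLik_eq hα, ← mul_sub, abs_mul, abs_of_pos (by positivity), mul_assoc,
    ← (summable_likelihood hα hsum u y).tsum_sub (summable_likelihood hα hsum v y),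
    ← tsum_mul_right]
  gcongr
  rw [← Real.norm_eq_abs]
  refine tsum_of_norm_bounded (hsum.mul_right _).hasSum fun k => ?_
  have := hα k
  refine (abs_weighted_sub_le this (Real.exp_pos (-α k)).le).trans
    (mul_le_mul_of_nonneg_left ?_ (by positivity))
  rw [← inner_sub_left]
  exact abs_inner_basis_le φ _ k

lemma continuous_negLogLik (hα : ∀ k, 0 < α k) (hb : 0 < b)
    (hsum : Summable fun k => α k ^ (β / 2) * Real.exp (-α k)) (y : X) :
    Continuous fun u => negLogLik φ α b β u y :=
  (LipschitzWith.of_dist_le' (K := √2 / b * ∑' k, α k ^ (β / 2) * Real.exp (-α k)) fun u v => by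
    rw [Real.dist_eq, dist_eq_norm]
    exact abs_negLogLik_sub_le hα hb hsum u v y).continuous

lemma negLogLik_zero (y : X) : negLogLik φ α b β 0 y = 0 := by
  simp [negLogLik]

lemma hasSum_forwardOp [CompleteSpace X] (hexp : Summable fun k => Real.exp (-α k)) (x : X) :
    HasSum (fun k => (Real.exp (-α k) * inner ℝ x (φ k)) • φ k) (forwardOp φ α x) := by
  refine Summable.hasSum (Summable.of_norm_bounded (hexp.mul_right ‖x‖) fun k => ?_)
  rw [norm_smul, φ.orthonormal.1 k, mul_one, norm_mul, Real.norm_of_nonneg (Real.exp_pos _).le]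
  exact mul_le_mul_of_nonneg_left (abs_inner_basis_le φ x k) (Real.exp_pos _).le

variable [SecondCountableTopology X] [MeasurableSpace X] [BorelSpace X]

lemma measurable_negLogLik (hα : ∀ k, 0 < α k)
    (hsum : Summable fun k => α k ^ (β / 2) * Real.exp (-α k)) :
    Measurable fun p : X × X => negLogLik φ α b β p.1 p.2 := by
  simp_rw [negLogLik_eq hα]
  refine Measurable.const_mul ?_ _
  exact measurable_of_tendsto_metrizable (f := fun n (p : X × X) =>
      ∑ k ∈ Finset.range n, α k ^ (β / 2) *
        (|inner ℝ p.2 (φ k) - Real.exp (-α k) * inner ℝ p.1 (φ k)| - |inner ℝ p.2 (φ k)|))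
    (fun n => by fun_prop)
    (tendsto_pi_nhds.2 fun p => (summable_likelihood hα hsum p.1 p.2).hasSum.tendsto_sum_nat)

/-- By Fernique's theorem, the likelihood is integrable with respect to a Gaussian prior for every
value of the data. -/
lemma integrable_exp_neg_negLogLik [CompleteSpace X] (hα : ∀ k, 0 < α k) (hb : 0 < b)
    (hsum : Summable fun k => α k ^ (β / 2) * Real.exp (-α k)) (μ : Measure X) [IsGaussian μ]
    (y : X) : Integrable (fun u => Real.exp (-negLogLik φ α b β u y)) μ := by
  obtain ⟨C, hC, hint⟩ := IsGaussian.exists_integrable_exp_sq μ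
  set L := √2 / b * ∑' k, α k ^ (β / 2) * Real.exp (-α k)
  have hm : Continuous fun u => negLogLik φ α b β u y := continuous_negLogLik hα hb hsum y
  refine (hint.const_mul (Real.exp (L ^ 2 / (4 * C)))).mono'
    (by fun_prop) (Eventually.of_forall fun u => ?_)
  rw [Real.norm_of_nonneg (Real.exp_pos _).le, ← Real.exp_add]
  refine Real.exp_le_exp.2 ?_
  have h1 := abs_negLogLik_sub_le (φ := φ) hα hb hsum u 0 y
  rw [negLogLik_zero, sub_zero, sub_zero] at h1
  have h2 : L ^ 2 / (4 * C) + C * ‖u‖ ^ 2 - L * ‖u‖ = C * (‖u‖ - L / (2 * C)) ^ 2 := by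
    field_simp; ring
  have h3 : 0 ≤ C * (‖u‖ - L / (2 * C)) ^ 2 := by positivity
  linarith [neg_le_abs (negLogLik φ α b β u y)]

lemma measurable_forwardOp [CompleteSpace X] (hexp : Summable fun k => Real.exp (-α k)) :
    Measurable (forwardOp φ α) :=
  measurable_of_tendsto_metrizable (f := fun n (x : X) =>
      ∑ k ∈ Finset.range n, (Real.exp (-α k) * inner ℝ x (φ k)) • φ k)
    (fun n => by fun_prop)
    (tendsto_pi_nhds.2 fun x => (hasSum_forwardOp hexp x).tendsto_sum_nat)

/-- The noise translated by `K x` has the density `exp (-Φ(x, ·))` with respect to the noise. -/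
lemma IsLaplacian.lintegral_add_forwardOp [CompleteSpace X] {Ω : Type*} [MeasurableSpace Ω]
    {P : Measure Ω} [IsProbabilityMeasure P] (hα : ∀ k, 0 < α k) (hb : 0 < b)
    (hsum : Summable fun k => α k ^ (β / 2) * Real.exp (-α k))
    (hexp : Summable fun k => Real.exp (-α k)) {η : Ω → X} (hη : Measurable η)
    (hnoise : IsLaplacian P (fun k => φ k) (fun k => b ^ 2 * α k ^ (-β)) 0 η) (x : X)
    {f : X → ℝ≥0∞} (hf : Measurable f) :
    ∫⁻ y, f (y + forwardOp φ α x) ∂(P.map η) =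
      ∫⁻ y, f y * ENNReal.ofReal (Real.exp (-negLogLik φ α b β x y)) ∂(P.map η) := by
  obtain ⟨c, hc, hindep, hlaw, hser⟩ := hnoise
  have hprob : IsProbabilityMeasure (P.map η) := Measure.isProbabilityMeasure_map hη.aemeasurable
  have hsqrt : ∀ k, √(b ^ 2 * α k ^ (-β)) = b * α k ^ (-β / 2) := by
    intro k
    have hr : α k ^ (-β) = (α k ^ (-β / 2)) ^ 2 := by
      rw [← Real.rpow_natCast, ← Real.rpow_mul (hα k).le]; congr 1; push_cast; ring
    rw [hr, ← mul_pow, Real.sqrt_sq]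
    have := Real.rpow_pos_of_pos (hα k) (-β / 2)
    positivity
  have hcoord : ∀ k, HasIndepCoord (P.map η) (φ k) (laplaceReal 0 (b ^ 2 * α k ^ (-β))) := by
    intro k
    have := hasIndepCoord_map_of_hasSum φ.orthonormal hc hindep hser k
    rwa [hlaw k, inner_zero_left] at this
  let t : ℕ → ℝ := fun k => Real.exp (-α k) * inner ℝ x (φ k)
  let w : ℕ → ℝ → ℝ := fun k s => -(√2 * (|s - t k| - |s|) / √(b ^ 2 * α k ^ (-β)))
  have hw : ∀ k s, w k s = -(√2 / b) * (α k ^ (β / 2) * (|s - t k| - |s|)) := by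
    intro k s
    simp only [w]
    rw [hsqrt, mul_div_assoc, negLogLik_term_eq hα]
    ring
  have hmain := lintegral_add_of_summable (ν := P.map η) φ.orthonormal (hasSum_forwardOp hexp x) (w := w)
    (B := fun k => √2 / b * (α k ^ (β / 2) * Real.exp (-α k) * ‖x‖))
    (fun k => by fun_prop) ((hsum.mul_right ‖x‖).mul_left (√2 / b))
    (fun k s => ?_)
    (fun k g hg => ?_) hf
  · rw [hmain]
    congr 1 with y
    congr 3
    rw [negLogLik_eq hα, ← neg_mul, ← tsum_mul_left]
    exact tsum_congr fun k => hw k _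
  · have h := abs_weighted_sub_le (β := β) (y := s) (s := inner ℝ x (φ k)) (t := 0)
      (hα k) (Real.exp_pos (-α k)).le
    simp only [mul_zero, sub_zero, sub_self] at h
    have := hα k
    rw [hw, abs_mul, abs_neg, abs_of_pos (a := √2 / b) (by positivity)]
    gcongr
    exact h.trans (mul_le_mul_of_nonneg_left (abs_inner_basis_le φ x k) (by positivity))
  · have : SFinite (laplaceReal 0 (b ^ 2 * α k ^ (-β))) := by
      unfold laplaceReal; infer_instance
    exact (hcoord k).lintegral_add_smul (φ.orthonormal.1 k)
      (q := fun s => ENNReal.ofReal (Real.exp (w k s))) (by fun_prop)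
      (fun g hg => lintegral_add_laplaceReal _ (t k) hg) hg

end Likelihood

/-! ### Minimizers -/

/-- A continuous function with at least quadratic growth `q t² - a |t|` and value `0` at the origin
has a minimizer, whose size is controlled by `a / q`. -/
lemma exists_forall_le_of_quadratic_growth {f : ℝ → ℝ} (hf : Continuous f) (h0 : f 0 = 0)
    {a q : ℝ} (ha : 0 ≤ a) (hq : 0 < q) (hfq : ∀ t, q * t ^ 2 - a * |t| ≤ f t) :
    ∃ t₀, |t₀| ≤ a / q ∧ ∀ t, f t₀ ≤ f t := by
  have hR : 0 ≤ a / q := by positivity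
  obtain ⟨t₀, ht₀, hmin⟩ := (isCompact_Icc (a := -(a / q)) (b := a / q)).exists_isMinOn
    ⟨0, by simpa using hR⟩ hf.continuousOn
  refine ⟨t₀, abs_le.2 ht₀, fun t => ?_⟩
  by_cases ht : |t| ≤ a / q
  · exact hmin (abs_le.1 ht)
  · have h1 : f t₀ ≤ 0 := h0 ▸ hmin (show (0 : ℝ) ∈ Set.Icc _ _ by simpa using hR)
    have h2 : a < q * |t| := by
      rw [not_le, div_lt_iff₀ hq] at ht
      linarith
    have h3 : 0 ≤ |t| * (q * |t| - a) := mul_nonneg (abs_nonneg _) (by linarith)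
    have h4 : |t| * (q * |t| - a) = q * t ^ 2 - a * |t| := by rw [← sq_abs t]; ring
    linarith [hfq t]

/-! ### The posterior and its Onsager--Machlup functional -/

section Posterior

variable {X : Type*} [NormedAddCommGroup X] [InnerProductSpace ℝ X] {φ : HilbertBasis ℕ ℝ X}
    {α : ℕ → ℝ} {b β r τ : ℝ}

lemma omFunctional_eq (hα : ∀ k, 0 < α k) (y : X) (x : scaleSpace φ α τ) :
    omFunctional φ α b β r τ y x =
      √2 / b * ∑' k, α k ^ (β / 2) *
        (|inner ℝ y (φ k) - Real.exp (-α k) * inner ℝ (x : X) (φ k)| - |inner ℝ y (φ k)|) +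
      1 / (2 * r ^ 2) * ∑' k, α k ^ τ * |inner ℝ (x : X) (φ k)| ^ 2 := by
  rw [omFunctional, negLogLik_eq hα, scaleNorm_sq hα x.2]

/-- The functional is a sum of functions of the single coordinates; the minimizers of the summands
are the coordinates of a point of `X^τ`, because their size decays like `exp (-α_k)` up to powers
of `α_k`. -/
lemma exists_forall_omFunctional_le (hα : ∀ k, 0 < α k) (hb : 0 < b) (hr : 0 < r) {a : ℝ}
    (ha : 0 < a) (haα : ∀ k, a ≤ α k) (hτ : 0 ≤ τ)
    (hsum : Summable fun k => α k ^ (β / 2) * Real.exp (-α k))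
    (hsq : Summable fun k => α k ^ (β - τ) * Real.exp (-2 * α k)) (y : X) :
    ∃ ubar : scaleSpace φ α τ, ∀ x : scaleSpace φ α τ,
      omFunctional φ α b β r τ y ubar ≤ omFunctional φ α b β r τ y x := by
  let f : ℕ → ℝ → ℝ := fun k t => √2 / b * (α k ^ (β / 2) *
      (|inner ℝ y (φ k) - Real.exp (-α k) * t| - |inner ℝ y (φ k)|)) +
      1 / (2 * r ^ 2) * (α k ^ τ * |t| ^ 2)
  have hp : ∀ (k : ℕ) (s : ℝ), 0 < α k ^ s := fun k s => Real.rpow_pos_of_pos (hα k) s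
  have hmin : ∀ k, ∃ t₀, |t₀| ≤ √2 / b * (α k ^ (β / 2) * Real.exp (-α k)) /
      (1 / (2 * r ^ 2) * α k ^ τ) ∧ ∀ t, f k t₀ ≤ f k t := by
    intro k
    have := hp k (β / 2)
    have := hp k τ
    refine exists_forall_le_of_quadratic_growth (by fun_prop) (by simp [f])
      (by positivity) (by positivity) fun t => ?_
    have h := abs_weighted_sub_le (β := β) (y := inner ℝ y (φ k)) (s := t) (t := 0)
      (hα k) (Real.exp_pos (-α k)).le
    simp only [mul_zero, sub_zero, sub_self] at h
    have h1 := mul_le_mul_of_nonneg_left (neg_le_of_abs_le h) (a := √2 / b) (by positivity)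
    simp only [f, sq_abs]
    linarith
  choose t ht hft using hmin
  have hX : Summable fun k => α k ^ τ * |t k| ^ 2 := by
    refine Summable.of_nonneg_of_le (fun k => mul_nonneg (hp k τ).le (sq_nonneg _)) (fun k => ?_)
      (hsq.mul_left ((√2 / b * (2 * r ^ 2)) ^ 2))
    refine (mul_le_mul_of_nonneg_left (pow_le_pow_left₀ (abs_nonneg _) (ht k) 2)
      (hp k τ).le).trans_eq ?_
    have h1 : α k ^ (β - τ) = (α k ^ (β / 2)) ^ 2 / α k ^ τ := by
      rw [Real.rpow_sub (hα k), ← Real.rpow_natCast, ← Real.rpow_mul (hα k).le]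
      congr 2; push_cast; ring
    have h2 : Real.exp (-2 * α k) = Real.exp (-α k) ^ 2 := by
      rw [← Real.exp_nat_mul]; congr 1; push_cast; ring
    rw [h1, h2]
    have := (hp k τ).ne'
    field_simp
  have ht2 : Summable fun k => t k ^ 2 := by
    refine Summable.of_nonneg_of_le (fun k => sq_nonneg _) (fun k => ?_) (hX.mul_left (a ^ (-τ)))
    have h1 : 1 ≤ a ^ (-τ) * α k ^ τ := by
      rw [Real.rpow_neg ha.le, inv_mul_eq_div, one_le_div (Real.rpow_pos_of_pos ha _)]
      exact Real.rpow_le_rpow ha.le (haα k) hτ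
    rw [sq_abs, ← mul_assoc]
    exact le_mul_of_one_le_left (sq_nonneg _) h1
  obtain ⟨z, -, hz⟩ := exists_hasSum_smul_of_summable_sq φ ht2
  have hzX : z ∈ scaleSpace φ α τ := by
    rw [mem_scaleSpace_iff]; simpa only [hz] using hX
  have hI : ∀ x : scaleSpace φ α τ, HasSum (fun k => f k (inner ℝ (x : X) (φ k)))
      (omFunctional φ α b β r τ y x) := fun x => by
    rw [omFunctional_eq hα]
    exact ((summable_likelihood hα hsum (x : X) y).hasSum.mul_left _).add
      ((mem_scaleSpace_iff.1 x.2).hasSum.mul_left _)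
  refine ⟨⟨z, hzX⟩, fun x => hasSum_le (fun k => ?_) (hI ⟨z, hzX⟩) (hI x)⟩
  simp only [hz]
  exact hft k _

variable [CompleteSpace X] [SecondCountableTopology X] [MeasurableSpace X] [BorelSpace X]

lemma evidence_pos (hα : ∀ k, 0 < α k) (hb : 0 < b)
    (hsum : Summable fun k => α k ^ (β / 2) * Real.exp (-α k)) (μ : Measure X) [IsGaussian μ]
    (y : X) : 0 < evidence μ fun x => negLogLik φ α b β x y :=
  integral_exp_pos (integrable_exp_neg_negLogLik hα hb hsum μ y)

lemma ofReal_evidence (hα : ∀ k, 0 < α k) (hb : 0 < b)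
    (hsum : Summable fun k => α k ^ (β / 2) * Real.exp (-α k)) (μ : Measure X) [IsGaussian μ]
    (y : X) : ∫⁻ x, ENNReal.ofReal (Real.exp (-negLogLik φ α b β x y)) ∂μ =
      ENNReal.ofReal (evidence μ fun x => negLogLik φ α b β x y) :=
  (ofReal_integral_eq_lintegral_ofReal (integrable_exp_neg_negLogLik hα hb hsum μ y)
    (Eventually.of_forall fun _ => (Real.exp_pos _).le)).symm

lemma isRegularCondDistrib_bayesPosterior (hα : ∀ k, 0 < α k) (hb : 0 < b)
    (hsum : Summable fun k => α k ^ (β / 2) * Real.exp (-α k))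
    (hexp : Summable fun k => Real.exp (-α k)) {Ω : Type*} [MeasurableSpace Ω] {P : Measure Ω}
    [IsProbabilityMeasure P] {u η : Ω → X} (hu : Measurable u) (hη : Measurable η)
    (hindep : IndepFun u η P) (hG : IsGaussian (P.map u))
    (hnoise : IsLaplacian P (fun k => φ k) (fun k => b ^ 2 * α k ^ (-β)) 0 η) :
    IsRegularCondDistrib P u (fun ω => forwardOp φ α (u ω) + η ω)
      (fun y => bayesPosterior (P.map u) fun x => negLogLik φ α b β x y) := by
  have hm : Measurable fun p : X × X => negLogLik φ α b β p.1 p.2 := measurable_negLogLik hα hsum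
  have hZ := ofReal_evidence (φ := φ) hα hb hsum (P.map u)
  have hZpos := evidence_pos (φ := φ) hα hb hsum (P.map u)
  have h := isRegularCondDistrib_of_lintegral_add hu hη hindep (measurable_forwardOp (φ := φ) hexp)
    (w := fun x y => ENNReal.ofReal (Real.exp (-negLogLik φ α b β x y)))
    (Measurable.ennreal_ofReal (by exact hm.neg.exp))
    (fun x f hf => hnoise.lintegral_add_forwardOp hα hb hsum hexp hη x hf)
    (fun y => by rw [hZ]; simpa using hZpos y) (fun y => by rw [hZ]; exact ENNReal.ofReal_ne_top)
  convert h using 1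
  · ext ω; exact add_comm _ _
  · ext1 y
    have hmy : Measurable fun x => negLogLik φ α b β x y := hm.comp (f := fun x => (x, y))
      (by fun_prop)
    rw [hZ, ← withDensity_smul _ (by fun_prop), bayesPosterior]
    congr 1 with x
    rw [Pi.smul_apply, smul_eq_mul, ← ENNReal.ofReal_inv_of_pos (hZpos y),
      ← ENNReal.ofReal_mul (inv_pos.2 (hZpos y)).le, div_eq_inv_mul]

/-- The posterior has a continuous positive density with respect to the Gaussian prior, so that it
has the same admissible shifts, and the logarithm of the density adds to the Onsager--Machlup
functional of the prior. -/
lemma isOnsagerMachlup_bayesPosterior (hα : ∀ k, 0 < α k) (hb : 0 < b) (hr : 0 < r)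
    (hsum : Summable fun k => α k ^ (β / 2) * Real.exp (-α k)) {μ : Measure X}
    (hμ : IsCenteredGaussian μ fun x => r ^ 2 • powA φ α (-τ) x) (y : X) :
    IsOnsagerMachlup (bayesPosterior μ fun x => negLogLik φ α b β x y)
      (scaleSpace φ α τ) (omFunctional φ α b β r τ y) := by
  have hG := hμ.isGaussian
  let v : ℕ → ℝ≥0 := fun k => (r ^ 2 * α k ^ (-τ)).toNNReal
  have hp : ∀ k, 0 < r ^ 2 * α k ^ (-τ) := fun k =>
    mul_pos (by positivity) (Real.rpow_pos_of_pos (hα k) _)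
  have hv' : ∀ k, (v k : ℝ) = r ^ 2 * α k ^ (-τ) := fun k => Real.coe_toNNReal _ (hp k).le
  have hv : ∀ k, v k ≠ 0 := fun k => by
    rw [← NNReal.coe_ne_zero, hv']; exact (hp k).ne'
  have hcoord : ∀ k, HasIndepCoord μ (φ k) (gaussianReal 0 (v k)) := fun k =>
    hμ.hasIndepCoord (φ.orthonormal.1 k) (by rw [powA_basis, smul_smul, hv'])
  have hterm : ∀ (x : X) k, inner ℝ x (φ k) ^ 2 / v k =
      1 / r ^ 2 * (α k ^ τ * |inner ℝ x (φ k)| ^ 2) := by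
    intro x k
    rw [hv', Real.rpow_neg (hα k).le, sq_abs]
    have := (Real.rpow_pos_of_pos (hα k) τ).ne'
    field_simp
  have hmem : ∀ x : X, x ∈ scaleSpace φ α τ ↔ Summable fun k => inner ℝ x (φ k) ^ 2 / v k := by
    intro x
    simp_rw [mem_scaleSpace_iff, hterm]
    exact (summable_mul_left_iff (by positivity)).symm
  set Z := evidence μ fun x => negLogLik φ α b β x y with hZ
  have hZpos : 0 < Z := evidence_pos hα hb hsum μ y
  have hcont : Continuous fun x => negLogLik φ α b β x y := continuous_negLogLik hα hb hsum y
  let D : X → ℝ := fun x => Real.exp (-negLogLik φ α b β x y) / Z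
  have hD : Continuous D := by fun_prop
  have hDpos : ∀ x, 0 < D x := fun x => div_pos (Real.exp_pos _) hZpos
  have hpost : bayesPosterior μ (fun x => negLogLik φ α b β x y) =
      μ.withDensity fun x => ENNReal.ofReal (D x) := rfl
  rw [hpost]
  refine ⟨?_, fun h₁ h₂ => ?_⟩
  · rw [admissibleShifts_eq φ (withDensity_absolutelyContinuous _ _)
      (withDensity_absolutelyContinuous' (by fun_prop)
        (Eventually.of_forall fun x => (ENNReal.ofReal_pos.2 (hDpos x)).ne')) hv hcoord]
    ext x
    exact hmem x
  · have h0 : ∀ ε : ℝ, 0 < ε → 0 < μ.real (Metric.ball 0 ε) := fun ε hε =>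
      ENNReal.toReal_pos (measure_ball_zero_pos φ hv hcoord hε).ne' (measure_ne_top _ _)
    have hlim : ∀ x : scaleSpace φ α τ, Tendsto (fun ε =>
        (μ.withDensity fun x => ENNReal.ofReal (D x)).real (Metric.ball (x : X) ε) /
          μ.real (Metric.ball 0 ε)) (𝓝[>] 0)
        (𝓝 (Real.exp (-omFunctional φ α b β r τ y x) / Z)) := by
      intro x
      have hx := (hmem x).1 x.2
      have hxpos : ∀ ε : ℝ, 0 < ε → 0 < μ.real (Metric.ball (x : X) ε) := fun ε hε =>
        ENNReal.toReal_pos (lt_of_lt_of_le (ENNReal.mul_pos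
          (ENNReal.ofReal_pos.2 (Real.exp_pos _)).ne' (measure_ball_zero_pos φ hv hcoord hε).ne')
          (exp_mul_measure_ball_zero_le φ hv hcoord hx hε.le)).ne' (measure_ne_top _ _)
      have h1 := (tendsto_withDensity_ball_div hD (fun x => (hDpos x).le) hxpos).mul
        (tendsto_measure_ball_div φ hv hcoord hx)
      have h2 : D x * Real.exp (-(∑' k, inner ℝ (x : X) (φ k) ^ 2 / v k) / 2) =
          Real.exp (-omFunctional φ α b β r τ y x) / Z := by
        simp only [D, hterm]
        rw [tsum_mul_left, omFunctional, scaleNorm_sq hα x.2, div_mul_eq_mul_div, ← Real.exp_add]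
        congr 2
        ring
      rw [h2] at h1
      refine h1.congr' ?_
      filter_upwards [self_mem_nhdsWithin] with ε hε
      exact div_mul_div_cancel₀ (hxpos ε hε).ne'
    have h3 := (hlim h₁).div (hlim h₂) (div_pos (Real.exp_pos _) hZpos).ne'
    have h4 : Real.exp (-omFunctional φ α b β r τ y h₁) / Z /
        (Real.exp (-omFunctional φ α b β r τ y h₂) / Z) =
        Real.exp (omFunctional φ α b β r τ y h₂ - omFunctional φ α b β r τ y h₁) := by
      rw [div_div_div_cancel_right₀ hZpos.ne', ← Real.exp_sub]
      congr 1; ring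
    rw [h4] at h3
    refine h3.congr' ?_
    filter_upwards [self_mem_nhdsWithin] with ε hε
    exact div_div_div_cancel_right₀ (h0 ε hε).ne' _ _

end Posterior

end OMHeat

theorem mainTheorem11
    {X : Type*} [NormedAddCommGroup X] [InnerProductSpace ℝ X] [CompleteSpace X]
    [SecondCountableTopology X] [MeasurableSpace X] [BorelSpace X]
    (φ : HilbertBasis ℕ ℝ X) (α : ℕ → ℝ) (d Cminus Cplus : ℝ)
    (hd : 0 < d) (hCminus : 0 < Cminus)
    (hα_pos : ∀ k, 0 < α k) (hα_mono : Monotone α)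
    (hα_lower : ∀ k : ℕ, Cminus * ((k : ℝ) + 1) ^ (2 / d) ≤ α k)
    (hα_upper : ∀ k : ℕ, α k ≤ Cplus * ((k : ℝ) + 1) ^ (2 / d))
    (b β r τ : ℝ) (hb : 0 < b) (hβ : d / 2 < β) (hr : 0 < r) (hτ : d / 2 < τ)
    -- unknown `u` and noise `η`: independent, with Gaussian resp. Laplacian distribution
    {Ω : Type*} [MeasurableSpace Ω] (P : Measure Ω) [IsProbabilityMeasure P]
    (u η : Ω → X) (hu : Measurable u) (hη : Measurable η) (hindep : IndepFun u η P)
    (μ₀ : Measure X) (hμ₀ : P.map u = μ₀)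
    (hprior : IsCenteredGaussian μ₀ fun x => r ^ 2 • powA φ α (-τ) x)
    (hnoise : IsLaplacian P (fun k => φ k) (fun k => b ^ 2 * α k ^ (-β)) 0 η) :
    -- the posterior: a regular conditional distribution of `u` given the data `K u + η`
    IsRegularCondDistrib P u (fun ω => forwardOp φ α (u ω) + η ω)
      (fun y => bayesPosterior μ₀ fun x => negLogLik φ α b β x y) ∧
    scaleSpace φ α τ = Set.range (powA φ α (-τ / 2)) ∧
    ∀ y : X,
      -- both series in the explicit form of `I^y` converge and represent it
      (∀ x : scaleSpace φ α τ,
        (Summable fun k => α k ^ (β / 2) *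
          (|inner ℝ y (φ k) - Real.exp (-α k) * inner ℝ (x : X) (φ k)| - |inner ℝ y (φ k)|)) ∧
        (Summable fun k => α k ^ τ * |inner ℝ (x : X) (φ k)| ^ 2) ∧
        omFunctional φ α b β r τ y x =
          √2 / b * ∑' k, α k ^ (β / 2) *
            (|inner ℝ y (φ k) - Real.exp (-α k) * inner ℝ (x : X) (φ k)| - |inner ℝ y (φ k)|) +
          1 / (2 * r ^ 2) * ∑' k, α k ^ τ * |inner ℝ (x : X) (φ k)| ^ 2) ∧
      IsOnsagerMachlup (bayesPosterior μ₀ fun x => negLogLik φ α b β x y)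
        (scaleSpace φ α τ) (omFunctional φ α b β r τ y) ∧
      ∃ ubar : scaleSpace φ α τ, ∀ x : scaleSpace φ α τ,
        omFunctional φ α b β r τ y ubar ≤ omFunctional φ α b β r τ y x := by
  have hsummable := fun p q hq => summable_rpow_mul_exp_neg hd hCminus hα_lower p (q := q) hq
  have hsum : Summable fun k => α k ^ (β / 2) * Real.exp (-α k) := by
    simpa using hsummable (β / 2) 1 one_pos
  have hexp : Summable fun k => Real.exp (-α k) := by simpa using hsummable 0 1 one_pos
  have hbdd : ∀ k, α 0 ≤ α k := fun k => hα_mono (Nat.zero_le k)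
  have hτ0 : 0 ≤ τ := by linarith
  subst hμ₀
  refine ⟨isRegularCondDistrib_bayesPosterior hα_pos hb hsum hexp hu hη hindep hprior.isGaussian
    hnoise, scaleSpace_eq_range (hα_pos 0) hbdd hτ0, fun y => ⟨fun x => ⟨?_, ?_, ?_⟩, ?_, ?_⟩⟩
  · exact summable_likelihood hα_pos hsum (x : X) y
  · exact mem_scaleSpace_iff.1 x.2
  · exact omFunctional_eq hα_pos y x
  · exact isOnsagerMachlup_bayesPosterior hα_pos hb hr hsum hprior y
  · exact exists_forall_omFunctional_le hα_pos hb hr (hα_pos 0) hbdd hτ0 hsum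
      (hsummable (β - τ) 2 two_pos) y
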